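/- All graphs are finite and simple. A set $X$ of vertices of a graph $G$ is dominating if every vertex of $G$ lies in $X$ or has a neighbour in $X$. The TARS-graph $\varepsilon(G)$ has the dominating sets of $G$ as its vertices; two dominating sets $X, Y$ are adjacent if and only if $Y$ is obtained from $X$ by adding or deleting a single vertex of $G$, or there are $u \in X$ and $v \in Y \setminus X$ that are adjacent in $G$ with $Y = (X \cup \{v\}) \setminus \{u\}$. A graph on $n$ vertices is pancyclic if it contains a cycle of length $\ell$ for every integer $\ell$ with $3 \le \ell \le n$. The join $G \vee H$ is the disjoint union of $G$ and $H$ together with all edges between $V(G)$ and $V(H)$. Theorem. Let $G$ and $H$ be graphs. If $\varepsilon(G)$ and $\varepsilon(H)$ are pancyclic, then $\varepsilon(G \vee H)$ is pancyclic. Consequently, $\varepsilon(G)$ is pancyclic whenever $G$ is a complete multipartite graph (the vertex set is partitioned into parts, and two vertices are adjacent if and only if they lie in different parts) and whenever $G$ is a complete split graph (the vertex set is partitioned into a clique $K$ and an independent set $I$, and every vertex of $K$ is adjacent to every vertex of $I$). -/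

import Mathlib

universe u v

namespace SimpleGraph

/-- `X` is a dominating set of `G`: every vertex lies in `X` or has a neighbour in `X`. -/
def IsDominatingSet {V : Type u} (G : SimpleGraph V) (X : Set V) : Prop :=
  ∀ w, w ∈ X ∨ ∃ x ∈ X, G.Adj x w

/-- Token addition/removal: `Y` is obtained from `X` by adding or deleting a single vertex. -/
def TARAdj {V : Type u} (X Y : Set V) : Prop :=
  (∃ w, w ∉ X ∧ Y = insert w X) ∨ (∃ w, w ∈ X ∧ Y = X \ {w})

/-- Token sliding: `Y` is obtained from `X` by exchanging `a ∈ X` for a neighbour `b` of `a`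
in `Y \ X`. -/
def TSAdj {V : Type u} (G : SimpleGraph V) (X Y : Set V) : Prop :=
  ∃ a ∈ X, ∃ b ∈ Y \ X, G.Adj a b ∧ Y = (X ∪ {b}) \ {a}

theorem TARAdj.symm {V : Type u} {X Y : Set V} (h : TARAdj X Y) : TARAdj Y X := by
  rcases h with ⟨w, hw, rfl⟩ | ⟨w, hw, rfl⟩
  · refine Or.inr ⟨w, Set.mem_insert _ _, ?_⟩
    ext z; simp only [Set.mem_sdiff, Set.mem_insert_iff, Set.mem_singleton_iff]; grind
  · refine Or.inl ⟨w, by simp, ?_⟩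
    ext z; simp only [Set.mem_sdiff, Set.mem_insert_iff, Set.mem_singleton_iff]; grind

theorem TSAdj.symm {V : Type u} {G : SimpleGraph V} {X Y : Set V} (h : TSAdj G X Y) :
    TSAdj G Y X := by
  obtain ⟨a, ha, b, ⟨hbY, hbX⟩, hab, hY⟩ := h
  have hne : a ≠ b := hab.ne
  refine ⟨b, hbY, a, ⟨ha, by rw [hY]; simp⟩, hab.symm, ?_⟩
  rw [hY]; ext z
  simp only [Set.mem_sdiff, Set.mem_union, Set.mem_singleton_iff]; grind

/-- The TARS-graph of `G`: its vertices are the dominating sets of `G`, and two of them are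
adjacent if they are related by token addition/removal or by token sliding. -/
def tarsGraph {V : Type u} (G : SimpleGraph V) :
    SimpleGraph {X : Set V // G.IsDominatingSet X} where
  Adj X Y := TARAdj X.1 Y.1 ∨ TSAdj G X.1 Y.1
  symm := ⟨fun _ _ h => h.imp TARAdj.symm TSAdj.symm⟩
  loopless := ⟨by
    rintro ⟨X, _⟩ ((⟨w, hw, h⟩ | ⟨w, hw, h⟩) | ⟨a, _, b, ⟨hb, hb'⟩, _⟩)
    · have h : X = insert w X := h
      exact hw (h.symm.subset (Set.mem_insert w X))
    · have h : X = X \ {w} := h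
      exact (h.subset hw).2 rfl
    · exact hb' hb⟩

/-- A finite graph on `n` vertices is pancyclic if it has a cycle of every length `ℓ` with
`3 ≤ ℓ ≤ n`. -/
def IsPancyclic {V : Type u} [Finite V] (G : SimpleGraph V) : Prop :=
  ∀ ℓ : ℕ, 3 ≤ ℓ → ℓ ≤ Nat.card V → ∃ (x : V) (p : G.Walk x x), p.IsCycle ∧ p.length = ℓ

/-- The join of `G` and `H`: their disjoint union together with all edges between them. -/
def join {V : Type u} {W : Type v} (G : SimpleGraph V) (H : SimpleGraph W) :
    SimpleGraph (V ⊕ W) :=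
  (G ⊕g H) ⊔ completeBipartiteGraph V W

/-- A complete split graph: the vertex set is partitioned into a clique `K` and an independent
set, with every vertex of `K` adjacent to every vertex of the independent set. -/
def IsCompleteSplit {V : Type u} (G : SimpleGraph V) : Prop :=
  ∃ K : Set V, G.IsClique K ∧ G.IsIndepSet Kᶜ ∧ ∀ x ∈ K, ∀ y ∉ K, G.Adj x y

end SimpleGraph

/-! ### Paths and cycles of prescribed lengths in a relation -/

namespace TarsCycles

open Set

/-! A dominating set of the join has both traces nonempty, or one trace empty and the other
dominating in its own graph (`Dom.cases`). Order the subsets of `V` and of `W` by Gray codes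
starting at `∅`. The pairs of nonempty sets become a `p × q` grid, `p = 2 ^ |V| - 1` and `q = 2 ^
|W| - 1`. Each unit square has a diagonal, since trading `a ∈ V` for `b ∈ W` is a slide along the
join edge `a b`. The dominating sets of `G` lie in column `0`, those of `H` in row `0`.

In the TARS-graph of `G`, the full set is adjacent only to complements of single vertices. A
Hamiltonian cycle thus gives a Hamiltonian path from `V` to some `V \ {v}`
(`exists_dominating_path`). With Gray codes in which `V` and `V \ {v}` are consecutive and `{w}` has
position `1`, this path is a detour along one edge of column `1`. Symmetrically, the dominating sets
of `H` form a detour along an edge of row `1`.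

It remains to find cycles of all lengths in a triangulated grid, with either detour included or not
(`TriangulatedGrid.hasCycle`). Cycles grow from one edge by gluing squares, and the diagonals allow
vertices to be skipped, so that the available lengths fill intervals. Both sides of the grid are
odd, so pairing rows cannot exhaust it; one extra diagonal near the end of rows `4` and `5` catches
the odd vertex.

Two small cases need their own arguments: for `|W| = 1` the grid is replaced by a cube, and for `|V|
= |W| = 2` by an explicit `3 × 3` grid. Complete multipartite and complete split graphs are iterated
joins of edgeless graphs. -/

/-- There is an `r`-path from `a` to `b` with exactly `k` distinct interior vertices,
all of which lie in `S`. -/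
def PathThrough {α : Type*} (r : α → α → Prop) (S : Set α) (a b : α) (k : ℕ) : Prop :=
  ∃ l : List α, l.length = k ∧ l.Nodup ∧ (∀ x ∈ l, x ∈ S) ∧ List.IsChain r (a :: (l ++ [b]))

/-- The relation `r` has a cycle on `k` vertices. -/
def HasCycle {α : Type*} (r : α → α → Prop) (k : ℕ) : Prop :=
  ∃ (a : α) (l : List α), l.length + 1 = k ∧ (a :: l).Nodup ∧ List.IsChain r (a :: (l ++ [a]))

/-- The interval `[lo, hi]` is nonempty, and each of its members is the number of interior
vertices of some path from `a` to `b` through `S`. -/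
def Fill {α : Type*} (r : α → α → Prop) (S : Set α) (a b : α) (lo hi : ℕ) : Prop :=
  lo ≤ hi ∧ ∀ k, lo ≤ k → k ≤ hi → PathThrough r S a b k

section

variable {α β : Type*} {r : α → α → Prop} {S T S₁ S₂ S₃ : Set α} {a b c d : α} {k k₁ k₂ : ℕ}

theorem PathThrough.mono (h : PathThrough r S a b k) (hST : S ⊆ T) : PathThrough r T a b k := by
  obtain ⟨l, h1, h2, h3, h4⟩ := h
  exact ⟨l, h1, h2, fun x hx => hST (h3 x hx), h4⟩

theorem PathThrough.symm (hr : ∀ x y, r x y → r y x) (h : PathThrough r S a b k) :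
    PathThrough r S b a k := by
  obtain ⟨l, h1, h2, h3, h4⟩ := h
  refine ⟨l.reverse, by simpa, by simpa, by simpa using h3, ?_⟩
  have : (b :: (l.reverse ++ [a])) = (a :: (l ++ [b])).reverse := by simp
  rw [this, List.isChain_reverse]
  exact h4.imp hr

theorem PathThrough.of_rel (h : r a b) : PathThrough r S a b 0 :=
  ⟨[], rfl, List.nodup_nil, by simp, by simpa using h⟩

theorem PathThrough.trans (h₁ : PathThrough r S₁ a c k₁) (h₂ : PathThrough r S₂ c b k₂)
    (h : ∀ x, (x ∈ S₁ → x ∈ S ∧ x ∉ S₂ ∧ x ≠ c) ∧ (x ∈ S₂ → x ∈ S ∧ x ≠ c)) (hc : c ∈ S) :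
    PathThrough r S a b (k₁ + k₂ + 1) := by
  obtain ⟨l, h1, h2, h3, h4⟩ := h₁
  obtain ⟨m, g1, g2, g3, g4⟩ := h₂
  refine ⟨l ++ c :: m, by simp [h1, g1]; omega, ?_, ?_, ?_⟩
  · rw [List.nodup_append]
    refine ⟨h2, ?_, ?_⟩
    · rw [List.nodup_cons]
      exact ⟨fun hc => ((h c).2 (g3 c hc)).2 rfl, g2⟩
    · intro x hx y hy hxy
      subst hxy
      rcases List.mem_cons.1 hy with rfl | hy
      · exact ((h _).1 (h3 _ hx)).2.2 rfl
      · exact ((h _).1 (h3 _ hx)).2.1 (g3 _ hy)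
  · intro x hx
    rcases List.mem_append.1 hx with hx | hx
    · exact ((h x).1 (h3 x hx)).1
    · rcases List.mem_cons.1 hx with rfl | hx
      · exact hc
      · exact ((h x).2 (g3 x hx)).1
  · have e : a :: (l ++ c :: m ++ [b]) = (a :: l) ++ c :: (m ++ [b]) := by simp
    rw [e, List.isChain_split]
    exact ⟨by simpa using h4, g4⟩

theorem PathThrough.map {s : β → β → Prop} {f : α → β} (hf : Function.Injective f)
    (hrs : ∀ x y, r x y → s (f x) (f y)) (h : PathThrough r S a b k) :
    PathThrough s (f '' S) (f a) (f b) k := by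
  obtain ⟨l, h1, h2, h3, h4⟩ := h
  refine ⟨l.map f, by simpa, h2.map hf, ?_, ?_⟩
  · intro x hx
    obtain ⟨y, hy, rfl⟩ := List.mem_map.1 hx
    exact ⟨y, h3 y hy, rfl⟩
  · have := List.isChain_map_of_isChain f hrs h4
    simpa using this

theorem PathThrough.hasCycle (h₁ : PathThrough r S₁ a b k₁) (h₂ : PathThrough r S₂ b a k₂)
    (h : ∀ x, (x ∈ S₁ → x ∉ S₂ ∧ x ≠ a ∧ x ≠ b) ∧ (x ∈ S₂ → x ≠ a ∧ x ≠ b)) (hab : a ≠ b) :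
    HasCycle r (k₁ + k₂ + 2) := by
  obtain ⟨l, h1, h2, h3, h4⟩ := h₁
  obtain ⟨m, g1, g2, g3, g4⟩ := h₂
  refine ⟨a, l ++ b :: m, by simp [h1, g1]; omega, ?_, ?_⟩
  · rw [List.nodup_cons, List.nodup_append]
    refine ⟨?_, h2, ?_, ?_⟩
    · intro ha
      rcases List.mem_append.1 ha with hx | hx
      · exact ((h a).1 (h3 a hx)).2.1 rfl
      · rcases List.mem_cons.1 hx with hx | hx
        · exact hab hx
        · exact ((h a).2 (g3 a hx)).1 rfl
    · rw [List.nodup_cons]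
      exact ⟨fun hc => ((h b).2 (g3 b hc)).2 rfl, g2⟩
    · intro x hx y hy hxy
      subst hxy
      rcases List.mem_cons.1 hy with rfl | hy
      · exact ((h _).1 (h3 _ hx)).2.2 rfl
      · exact ((h _).1 (h3 _ hx)).1 (g3 _ hy)
  · have e : a :: (l ++ b :: m ++ [a]) = (a :: l) ++ b :: (m ++ [a]) := by simp
    rw [e, List.isChain_split]
    exact ⟨by simpa using h4, g4⟩

theorem exists_rel_of_mem_cycle {l : List α} (h : (a :: (l ++ [a])).IsChain r) (hb : b ∈ a :: l) :
    ∃ x, r b x := by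
  obtain ⟨s, t, e⟩ := List.append_of_mem hb
  rw [← List.cons_append, e, List.append_assoc, List.cons_append] at h
  have h := h.right_of_append
  cases t with
  | nil => exact ⟨_, List.isChain_pair.1 h⟩
  | cons w t => exact ⟨_, (List.isChain_cons_cons.1 h).1⟩

/-- Each vertex of a cycle has an outgoing relation and hence lies in the range of `f`, so the whole
cycle pulls back. -/
theorem HasCycle.of_map {f : α → β} (hf : Function.Injective f)
    (h : HasCycle (Relation.Map r f f) k) : HasCycle r k := by
  obtain ⟨a, l, h1, h2, h3⟩ := h
  have hmem : ∀ x ∈ a :: l, x ∈ Set.range f := fun x hx => by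
    obtain ⟨_, y, _, _, rfl, _⟩ := exists_rel_of_mem_cycle h3 hx
    exact ⟨y, rfl⟩
  obtain ⟨m, hm⟩ : ∃ m : List α, m.map f = a :: l := by
    have : a :: l ∈ Set.range (List.map f) := by
      rw [Set.range_list_map]; exact hmem
    exact this
  cases m with
  | nil => simp at hm
  | cons a' l' =>
    rw [List.map_cons, List.cons.injEq] at hm
    obtain ⟨rfl, rfl⟩ := hm
    refine ⟨a', l', by simpa using h1, ?_, ?_⟩
    · rw [← List.map_cons, List.nodup_map_iff hf] at h2
      exact h2
    · have e : f a' :: (l'.map f ++ [f a']) = (a' :: (l' ++ [a'])).map f := by simp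
      rw [e, List.isChain_map] at h3
      refine h3.imp ?_
      rintro x y ⟨x', y', hxy, hx, hy⟩
      rwa [← hf hx, ← hf hy]

variable {l₁ l₂ l₃ u₁ u₂ u₃ lo : ℕ}

theorem Fill.of_rel (h : r a b) : Fill r S a b 0 0 :=
  ⟨le_rfl, fun k _ hk => by
    obtain rfl : k = 0 := by omega
    exact .of_rel h⟩

theorem PathThrough.fill (h : PathThrough r S a b k) : Fill r S a b k k :=
  ⟨le_rfl, fun j h1 h2 => by
    obtain rfl : j = k := by omega
    exact h⟩

theorem Fill.mono {lo hi : ℕ} (h : Fill r S a b lo hi) (hST : S ⊆ T) : Fill r T a b lo hi :=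
  ⟨h.1, fun k h1 h2 => (h.2 k h1 h2).mono hST⟩

theorem Fill.symm {lo hi : ℕ} (h : Fill r S a b lo hi) (hr : ∀ x y, r x y → r y x) :
    Fill r S b a lo hi :=
  ⟨h.1, fun k h1 h2 => (h.2 k h1 h2).symm hr⟩

theorem Fill.trans (h₁ : Fill r S₁ a c l₁ u₁) (h₂ : Fill r S₂ c b l₂ u₂)
    (h : ∀ x, (x ∈ S₁ → x ∈ S ∧ x ∉ S₂ ∧ x ≠ c) ∧ (x ∈ S₂ → x ∈ S ∧ x ≠ c)) (hc : c ∈ S) :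
    Fill r S a b (l₁ + l₂ + 1) (u₁ + u₂ + 1) := by
  obtain ⟨h1, h1'⟩ := h₁
  obtain ⟨h2, h2'⟩ := h₂
  refine ⟨by omega, fun k hk hk' => ?_⟩
  -- The sum of two integer intervals is an interval: give the first path as few vertices as the
  -- upper bound on the second permits. The `1` counts `c`.
  have e : k = (max l₁ (k - 1 - u₂)) + (k - 1 - max l₁ (k - 1 - u₂)) + 1 := by omega
  rw [e]
  exact (h1' _ (by omega) (by omega)).trans (h2' _ (by omega) (by omega)) h hc

theorem Fill.triangle (h₁ : Fill r S₁ a c 0 u₁) (h₂ : Fill r S₂ c b 0 u₂) (hab : r a b)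
    (h : ∀ x, (x ∈ S₁ → x ∈ S ∧ x ∉ S₂ ∧ x ≠ c) ∧ (x ∈ S₂ → x ∈ S ∧ x ≠ c)) (hc : c ∈ S) :
    Fill r S a b 0 (u₁ + u₂ + 1) := by
  refine ⟨by omega, fun k _ hk' => ?_⟩
  rcases Nat.eq_zero_or_pos k with rfl | hk
  · exact .of_rel hab
  · exact (h₁.trans h₂ h hc).2 k (by omega) hk'

/-- Attach the square `a, c, d, b` to the edge `a b`. If all lower bounds vanish and one diagonal
is present, then the new vertices may be omitted. -/
theorem Fill.square (h₁ : Fill r S₁ a c l₁ u₁) (h₂ : Fill r S₂ c d l₂ u₂)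
    (h₃ : Fill r S₃ d b l₃ u₃)
    (h : ∀ x, (x ∈ S₁ → x ∈ S ∧ x ∉ S₂ ∧ x ∉ S₃ ∧ x ≠ c ∧ x ≠ d) ∧
      (x ∈ S₂ → x ∈ S ∧ x ∉ S₃ ∧ x ≠ c ∧ x ≠ d) ∧ (x ∈ S₃ → x ∈ S ∧ x ≠ c ∧ x ≠ d))
    (hc : c ∈ S) (hd : d ∈ S) (hcd : c ≠ d)
    (hlo : l₁ + l₂ + l₃ + 2 = lo ∨
      lo = 0 ∧ l₁ = 0 ∧ l₂ = 0 ∧ l₃ = 0 ∧ r a b ∧ (r a d ∨ r c b)) :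
    Fill r S a b lo (u₁ + u₂ + u₃ + 2) := by
  have H₁ : ∀ x, (x ∈ S₁ → x ∈ insert c (S₁ ∪ S₂) ∧ x ∉ S₂ ∧ x ≠ c) ∧
      (x ∈ S₂ → x ∈ insert c (S₁ ∪ S₂) ∧ x ≠ c) := fun x =>
    ⟨fun hx => ⟨Or.inr (Or.inl hx), ((h x).1 hx).2.1, ((h x).1 hx).2.2.2.1⟩,
      fun hx => ⟨Or.inr (Or.inr hx), ((h x).2.1 hx).2.2.1⟩⟩
  have H₂ : ∀ x, (x ∈ S₂ → x ∈ insert d (S₂ ∪ S₃) ∧ x ∉ S₃ ∧ x ≠ d) ∧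
      (x ∈ S₃ → x ∈ insert d (S₂ ∪ S₃) ∧ x ≠ d) := fun x =>
    ⟨fun hx => ⟨Or.inr (Or.inl hx), ((h x).2.1 hx).2.1, ((h x).2.1 hx).2.2.2⟩,
      fun hx => ⟨Or.inr (Or.inr hx), ((h x).2.2 hx).2.2⟩⟩
  have K₁ : ∀ x, (x ∈ insert c (S₁ ∪ S₂) → x ∈ S ∧ x ∉ S₃ ∧ x ≠ d) ∧
      (x ∈ S₃ → x ∈ S ∧ x ≠ d) := by
    refine fun x => ⟨?_, fun hx => ⟨((h x).2.2 hx).1, ((h x).2.2 hx).2.2⟩⟩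
    rintro (rfl | hx | hx)
    · exact ⟨hc, fun h' => ((h x).2.2 h').2.1 rfl, hcd⟩
    · exact ⟨((h x).1 hx).1, ((h x).1 hx).2.2.1, ((h x).1 hx).2.2.2.2⟩
    · exact ⟨((h x).2.1 hx).1, ((h x).2.1 hx).2.1, ((h x).2.1 hx).2.2.2⟩
  have K₂ : ∀ x, (x ∈ S₁ → x ∈ S ∧ x ∉ insert d (S₂ ∪ S₃) ∧ x ≠ c) ∧
      (x ∈ insert d (S₂ ∪ S₃) → x ∈ S ∧ x ≠ c) := by
    refine fun x => ⟨fun hx => ⟨((h x).1 hx).1, ?_, ((h x).1 hx).2.2.2.1⟩, ?_⟩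
    · rintro (h' | h' | h')
      · exact ((h x).1 hx).2.2.2.2 h'
      · exact ((h x).1 hx).2.1 h'
      · exact ((h x).1 hx).2.2.1 h'
    · rintro (rfl | hx | hx)
      · exact ⟨hd, hcd.symm⟩
      · exact ⟨((h x).2.1 hx).1, ((h x).2.1 hx).2.2.1⟩
      · exact ⟨((h x).2.2 hx).1, ((h x).2.2 hx).2.1⟩
  -- A diagonal splits the square into two triangles, glued one onto the other; the direct edge of
  -- each makes its apex optional.
  rcases hlo with rfl | ⟨rfl, rfl, rfl, rfl, hab, had | hcb⟩
  · convert (h₁.trans h₂ H₁ (Set.mem_insert _ _)).trans h₃ K₁ hd using 1 <;> omega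
  · convert (h₁.triangle h₂ had H₁ (Set.mem_insert _ _)).triangle h₃ hab K₁ hd using 1; omega
  · convert h₁.triangle (h₂.triangle h₃ hcb H₂ (Set.mem_insert _ _)) hab K₂ hc using 1; omega

theorem Fill.cast {lo' hi hi' : ℕ} (h : Fill r S a b lo hi) (h₁ : lo = lo') (h₂ : hi = hi') :
    Fill r S a b lo' hi' := h₁ ▸ h₂ ▸ h

end

end TarsCycles

set_option linter.unusedSimpArgs false

/-! ### Cycles of all lengths in a triangulated grid with detours -/

namespace TarsCycles

open Set

/-- A symmetric relation on `ℕ × ℕ` that contains the `p × q` grid on `[1, p] × [1, q]` and a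
diagonal of each of its unit squares. -/
structure TriangulatedGrid (r : ℕ × ℕ → ℕ × ℕ → Prop) (p q : ℕ) : Prop where
  symm : ∀ x y, r x y → r y x
  vert : ∀ i j, 1 ≤ i → i < p → 1 ≤ j → j ≤ q → r (i, j) (i + 1, j)
  horiz : ∀ i j, 1 ≤ i → i ≤ p → 1 ≤ j → j < q → r (i, j) (i, j + 1)
  diag : ∀ i j, 1 ≤ i → i < p → 1 ≤ j → j < q →
    r (i, j) (i + 1, j + 1) ∨ r (i, j + 1) (i + 1, j)

namespace TriangulatedGrid

variable {r : ℕ × ℕ → ℕ × ℕ → Prop} {p q : ℕ}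

theorem diag' (hg : TriangulatedGrid r p q) {i j : ℕ} (h1 : 1 ≤ i) (h2 : i < p) (h3 : 1 ≤ j)
    (h4 : j < q) : r (i, j) (i + 1, j + 1) ∨ r (i + 1, j) (i, j + 1) :=
  (hg.diag i j h1 h2 h3 h4).imp_right (hg.symm _ _)

/-- Two consecutive rows of the grid, to the right of column `j`. -/
theorem fill_rows (hg : TriangulatedGrid r p q) {i : ℕ} (hi : 1 ≤ i) (hip : i < p) (d j : ℕ)
    (hj : 1 ≤ j) (hd : j + d = q) :
    Fill r {x | (x.1 = i ∨ x.1 = i + 1) ∧ j < x.2 ∧ x.2 ≤ q} (i, j) (i + 1, j) 0 (2 * d) := by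
  induction d generalizing j with
  | zero => exact .of_rel (hg.vert i j hi hip hj (by omega))
  | succ d ih =>
    refine (Fill.square (S₁ := ∅) (S₃ := ∅) (.of_rel (hg.horiz i j hi hip.le hj (by omega)))
      (ih (j + 1) (by omega) (by omega))
      (.of_rel (hg.symm _ _ (hg.horiz (i + 1) j (by omega) (by omega) hj (by omega))))
      ?_ ?_ ?_ ?_ (Or.inr ⟨rfl, rfl, rfl, rfl, hg.vert i j hi hip hj (by omega), ?_⟩)).cast rfl
      (by omega)
    · rintro ⟨x, y⟩
      simp only [mem_ofPred_eq, mem_empty_iff_false, Prod.mk.injEq, ne_eq,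
        false_imp_iff, true_and, and_true, not_false_eq_true, true_or, or_true]
      omega
    · simp only [mem_ofPred_eq, true_and, true_or, or_true]; omega
    · simp only [mem_ofPred_eq, true_and, true_or, or_true]; omega
    · simp
    · exact hg.diag i j hi hip hj (by omega)

/-- The first two rows of the grid to the right of column `j`, with a detour outside of the grid
along the edge from `(1, t)` to `(1, t + 1)`. For `e = 1` all vertices are used,
for `e = 0` all of them may be omitted. -/
theorem fill_first_rows (hg : TriangulatedGrid r p q) (hp : 2 ≤ p) {t k e : ℕ}
    (hB : PathThrough r {x | x.1 = 0 ∧ 0 < x.2} (1, t) (1, t + 1) k) (he : e = 1 ∨ e = 0 ∧ k = 0)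
    (d j : ℕ) (hj : 1 ≤ j) (hd : j + d = q) (ht : t < q) :
    Fill r {x | (x.1 = 1 ∨ x.1 = 2) ∧ j < x.2 ∧ x.2 ≤ q ∨ x.1 = 0 ∧ 0 < x.2 ∧ j ≤ t}
      (1, j) (2, j) (e * (2 * d) + if j ≤ t then k else 0) (2 * d + if j ≤ t then k else 0) := by
  induction d generalizing j with
  | zero =>
    rw [if_neg (by omega)]
    exact (Fill.of_rel (hg.vert 1 j le_rfl (by omega) hj (by omega))).cast (by omega) rfl
  | succ d ih =>
    have hbot : Fill r {x | x.1 = 0 ∧ 0 < x.2 ∧ j = t} (1, j) (1, j + 1)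
        (if j = t then k else 0) (if j = t then k else 0) := by
      split_ifs with hjt
      · subst hjt
        simpa using hB.fill
      · exact .of_rel (hg.horiz 1 j le_rfl (by omega) hj (by omega))
    refine (Fill.square (S₃ := ∅)
      (lo := e * (2 * (d + 1)) + if j ≤ t then k else 0) hbot
      (ih (j + 1) (by omega) (by omega))
      (.of_rel (hg.symm _ _ (hg.horiz 2 j (by omega) (by omega) hj (by omega))))
      ?_ ?_ ?_ ?_ ?_).cast rfl (by split_ifs <;> omega)
    · rintro ⟨x, y⟩
      simp only [mem_ofPred_eq, mem_empty_iff_false, Prod.mk.injEq, ne_eq,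
        false_imp_iff, true_and, and_true, not_false_eq_true, true_or, or_true]
      omega
    · simp only [mem_ofPred_eq, true_and, true_or, or_true]; omega
    · simp only [mem_ofPred_eq, true_and, true_or, or_true]; omega
    · simp
    · rcases he with rfl | ⟨rfl, rfl⟩
      · left; split_ifs <;> omega
      · right
        simp only [ite_self]
        exact ⟨by omega, trivial, by omega, trivial, hg.vert 1 j le_rfl (by omega) hj (by omega),
          hg.diag 1 j le_rfl (by omega) hj (by omega)⟩

/-- Rows `3`, `4` and `5` of the grid to the right of an even column `j`. -/
theorem fill_three_rows (hg : TriangulatedGrid r p q) (hp : 5 ≤ p)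
    (hcorner : r (4, q - 1) (5, q)) (d j : ℕ) (hj : 1 ≤ j) (hd : j + 1 + 2 * d = q) :
    Fill r {x | 3 ≤ x.1 ∧ x.1 ≤ 5 ∧ j < x.2 ∧ x.2 ≤ q} (3, j) (4, j) 0 (6 * d + 3) := by
  induction d generalizing j with
  | zero =>
    obtain rfl : q = j + 1 := by omega
    -- The leftover vertex `(5, q)` is the apex of a triangle over the last edge of row `4`; its
    -- second side is the extra diagonal `hcorner`.
    have htop : Fill r {x | x = (5, j + 1)} (4, j + 1) (4, j) 0 1 := by
      refine (Fill.triangle (S₁ := ∅) (S₂ := ∅)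
        (.of_rel (hg.vert 4 (j + 1) (by omega) (by omega) (by omega) le_rfl))
        (.of_rel (hg.symm _ _ hcorner))
        (hg.symm _ _ (hg.horiz 4 j (by omega) (by omega) hj (by omega))) ?_ ?_)
      · simp
      · simp
    refine (Fill.square (S₁ := ∅) (S₂ := ∅) (.of_rel (hg.horiz 3 j (by omega) (by omega) hj
      (by omega))) (.of_rel (hg.vert 3 (j + 1) (by omega) (by omega) (by omega) (by omega)))
      htop ?_ ?_ ?_ ?_ (Or.inr ⟨rfl, rfl, rfl, rfl,
        hg.vert 3 j (by omega) (by omega) hj (by omega),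
        hg.diag 3 j (by omega) (by omega) hj (by omega)⟩)).cast rfl (by omega)
    · rintro ⟨x, y⟩
      simp only [mem_ofPred_eq, mem_empty_iff_false, Prod.mk.injEq, ne_eq,
        false_imp_iff, true_and, and_true, not_false_eq_true, true_or, or_true]
      omega
    · simp only [mem_ofPred_eq, true_and, true_or, or_true]; omega
    · simp only [mem_ofPred_eq, true_and, true_or, or_true]; omega
    · simp
  | succ d ih =>
    -- Rows `3` and `4` form a ladder; row `5` is attached two vertices at a time, as squares over
    -- every other edge of row `4`.
    have htop : Fill r {x | x = (5, j + 1) ∨ x = (5, j + 2)} (4, j + 2) (4, j + 1) 0 2 := by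
      refine (Fill.square (S₁ := ∅) (S₂ := ∅) (S₃ := ∅)
        (.of_rel (hg.vert 4 (j + 2) (by omega) (by omega) (by omega) (by omega)))
        (.of_rel (hg.symm _ _ (hg.horiz 5 (j + 1) (by omega) (by omega) (by omega) (by omega))))
        (.of_rel (hg.symm _ _ (hg.vert 4 (j + 1) (by omega) (by omega) (by omega) (by omega))))
        ?_ ?_ ?_ ?_ (Or.inr ⟨rfl, rfl, rfl, rfl,
          hg.symm _ _ (hg.horiz 4 (j + 1) (by omega) (by omega) (by omega) (by omega)),
          ((hg.diag 4 (j + 1) (by omega) (by omega) (by omega) (by omega)).symm).imp_right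
            (hg.symm _ _)⟩))
      · simp
      · simp
      · simp
      · simp
    have hmid : Fill r {x | 3 ≤ x.1 ∧ x.1 ≤ 5 ∧ j + 1 < x.2 ∧ x.2 ≤ q ∨ x = (5, j + 1)}
        (3, j + 1) (4, j + 1) 0 (6 * d + 7) := by
      refine (Fill.square (S₁ := ∅) (.of_rel (hg.horiz 3 (j + 1) (by omega) (by omega) (by omega)
        (by omega))) (ih (j + 2) (by omega) (by omega))
        htop ?_ ?_ ?_ ?_ (Or.inr ⟨rfl, rfl, rfl, rfl,
          hg.vert 3 (j + 1) (by omega) (by omega) (by omega) (by omega),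
          hg.diag 3 (j + 1) (by omega) (by omega) (by omega) (by omega)⟩)).cast rfl (by omega)
      · rintro ⟨x, y⟩
        simp only [mem_ofPred_eq, mem_empty_iff_false, Prod.mk.injEq, ne_eq,
          false_imp_iff, true_and, and_true, not_false_eq_true, true_or, or_true]
        omega
      · simp only [mem_ofPred_eq, true_and, true_or, or_true]; omega
      · simp only [mem_ofPred_eq, true_and, true_or, or_true]; omega
      · simp
    refine (Fill.square (S₁ := ∅) (S₃ := ∅) (.of_rel (hg.horiz 3 j (by omega) (by omega) hj
      (by omega))) hmid
      (.of_rel (hg.symm _ _ (hg.horiz 4 j (by omega) (by omega) hj (by omega))))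
      ?_ ?_ ?_ ?_ (Or.inr ⟨rfl, rfl, rfl, rfl,
        hg.vert 3 j (by omega) (by omega) hj (by omega),
        hg.diag 3 j (by omega) (by omega) hj (by omega)⟩)).cast rfl (by omega)
    · rintro ⟨x, y⟩
      simp only [mem_ofPred_eq, mem_empty_iff_false, Prod.mk.injEq, ne_eq,
        false_imp_iff, true_and, and_true, not_false_eq_true, true_or, or_true]
      omega
    · simp only [mem_ofPred_eq, true_and, true_or, or_true]; omega
    · simp only [mem_ofPred_eq, true_and, true_or, or_true]; omega
    · simp

/-- Prolong the first two columns downwards by one row, from row `i + 1` to row `i`. Along the left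
column there is a detour outside of the grid along the edge from `(s, 1)` to `(s + 1, 1)`. -/
theorem fill_spine_step (hg : TriangulatedGrid r p q) (hq : 2 ≤ q) {s k e i h b lt ut : ℕ}
    {S T U : Set (ℕ × ℕ)}
    (hA : PathThrough r {x | 0 < x.1 ∧ x.2 = 0} (s, 1) (s + 1, 1) k) (he : e = 1 ∨ e = 0 ∧ k = 0)
    (hi : 1 ≤ i) (hip : i < p)
    (hS : Fill r {x | x ∈ S ∨ 0 < x.1 ∧ x.2 = 0 ∧ i + 1 ≤ s} (i + 1, 1) (i + 1, 2)
      (e * b + if i + 1 ≤ s then k else 0) (h + if i + 1 ≤ s then k else 0))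
    (hT : Fill r T (i, 2) (i + 1, 2) (e * lt) ut)
    (hU : ∀ x y, ((x, y) ∈ S → (x, y) ∈ U ∧ (x, y) ∉ T ∧ 0 < y ∧ (i + 1 < x ∨ 3 ≤ y)) ∧
      ((x, y) ∈ T → (x, y) ∈ U ∧ 0 < y ∧ (x ≠ i + 1 ∨ 3 ≤ y)))
    (h1 : (i + 1, 1) ∈ U) (h2 : (i + 1, 2) ∈ U) :
    Fill r {x | x ∈ U ∨ 0 < x.1 ∧ x.2 = 0 ∧ i ≤ s} (i, 1) (i, 2)
      (e * (b + lt + 2) + if i ≤ s then k else 0) (h + ut + 2 + if i ≤ s then k else 0) := by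
  have hleft : Fill r {x | 0 < x.1 ∧ x.2 = 0 ∧ i = s} (i, 1) (i + 1, 1)
      (if i = s then k else 0) (if i = s then k else 0) := by
    split_ifs with his
    · subst his
      simpa using hA.fill
    · exact .of_rel (hg.vert i 1 hi hip le_rfl (by omega))
  -- The new square has three replaceable sides: the left one carries the detour when `i = s`, the
  -- far one the part already built, the right one the rows beyond column `2`.
  refine (Fill.square (lo := e * (b + lt + 2) + if i ≤ s then k else 0) hleft hS
    (hT.symm hg.symm) ?_ (Or.inl h1) (Or.inl h2) (by simp) ?_).cast rfl (by split_ifs <;> omega)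
  · rintro ⟨x, y⟩
    obtain ⟨hSx, hTx⟩ := hU x y
    simp only [mem_ofPred_eq, ne_eq, Prod.mk.injEq]
    refine ⟨fun hx => ⟨Or.inr (by omega), ?_, fun h => ?_, by omega, by omega⟩, ?_,
      fun hx => ⟨Or.inl (hTx hx).1, ?_, ?_⟩⟩
    · rintro (h | h)
      · have := (hSx h).2.2; omega
      · omega
    · have := (hTx h).2; omega
    · rintro (h | h)
      · have := (hSx h).2.2
        exact ⟨Or.inl (hSx h).1, (hSx h).2.1, by omega, by omega⟩
      · exact ⟨Or.inr (by omega), fun h' => by have := (hTx h').2; omega, by omega, by omega⟩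
    · have := (hTx hx).2; omega
    · have := (hTx hx).2; omega
  · rcases he with rfl | ⟨rfl, rfl⟩
    · left; split_ifs <;> omega
    · right
      simp only [ite_self, Nat.zero_mul, Nat.add_zero]
      exact ⟨trivial, trivial, trivial, trivial, hg.horiz i 1 hi hip.le le_rfl (by omega),
        hg.diag' hi hip le_rfl (by omega)⟩

/-- The part of the grid above an odd row `i ≥ 5`, seen from the first two columns. -/
theorem fill_above (hg : TriangulatedGrid r p q) (hq : 2 ≤ q) {s k e : ℕ}
    (hA : PathThrough r {x | 0 < x.1 ∧ x.2 = 0} (s, 1) (s + 1, 1) k) (he : e = 1 ∨ e = 0 ∧ k = 0)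
    (hs : s < p) (d i : ℕ) (hi : 1 ≤ i) (hd : i + 2 * d = p) :
    Fill r {x | x ∈ {x : ℕ × ℕ | i < x.1 ∧ x.1 ≤ p ∧ 0 < x.2 ∧ x.2 ≤ q} ∨
        0 < x.1 ∧ x.2 = 0 ∧ i ≤ s} (i, 1) (i, 2)
      (e * (4 * d) + if i ≤ s then k else 0) (2 * q * d + if i ≤ s then k else 0) := by
  induction d generalizing i with
  | zero =>
    rw [if_neg (by omega)]
    exact (Fill.of_rel (hg.horiz i 1 hi (by omega) le_rfl (by omega))).cast (by omega) rfl
  | succ d ih =>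
    -- Rows `i + 1` and `i + 2` are paired beyond column `2`; the step from row `i + 1` to row `i`
    -- then adds only the two spine vertices.
    have h := hg.fill_spine_step (i := i + 1) (T := {x | (x.1 = i + 1 ∨ x.1 = i + 1 + 1) ∧
      2 < x.2 ∧ x.2 ≤ q}) (lt := 0) (U := {x | (i + 1 < x.1 ∧ x.1 ≤ p ∧ 0 < x.2 ∧ x.2 ≤ q) ∨
        x.1 = i + 1 ∧ 2 < x.2 ∧ x.2 ≤ q}) hq hA he (by omega) (by omega)
      (ih (i + 2) (by omega) (by omega))
      (hg.fill_rows (by omega) (by omega) (q - 2) 2 (by omega) (by omega)) ?_ ?_ ?_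
    · refine (hg.fill_spine_step (i := i) (T := ∅) (lt := 0) (ut := 0)
        (U := {x | i < x.1 ∧ x.1 ≤ p ∧ 0 < x.2 ∧ x.2 ≤ q}) hq hA he hi (by omega) h
        (.of_rel (hg.vert i 2 hi (by omega) (by omega) hq)) ?_ ?_ ?_).cast (by ring) ?_
      · intro x y
        simp only [mem_ofPred_eq, mem_empty_iff_false, false_imp_iff, not_false_eq_true,
          true_and, and_true]
        omega
      · simp only [mem_ofPred_eq]; omega
      · simp only [mem_ofPred_eq]; omega
      · obtain ⟨q, rfl⟩ := Nat.exists_eq_add_of_le hq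
        rw [Nat.add_sub_cancel_left]
        ring
    · intro x y
      simp only [mem_ofPred_eq]
      omega
    · simp only [mem_ofPred_eq]; omega
    · simp only [mem_ofPred_eq]; omega

/-- The whole grid together with detours of length `k` and `l` outside of it. -/
theorem fill_all (hg : TriangulatedGrid r p q) (hp : Odd p) (hp' : 7 ≤ p) (hq : Odd q)
    (hq' : 3 ≤ q) (hcorner : r (4, q - 1) (5, q)) {s t k l e : ℕ} (hs : 1 ≤ s) (hs' : s < p)
    (ht : 2 ≤ t) (ht' : t < q)
    (hA : PathThrough r {x | 0 < x.1 ∧ x.2 = 0} (s, 1) (s + 1, 1) k)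
    (hB : PathThrough r {x | x.1 = 0 ∧ 0 < x.2} (1, t) (1, t + 1) l)
    (he : e = 1 ∨ e = 0 ∧ k = 0 ∧ l = 0) :
    Fill r ({(1, 1), (1, 2)}ᶜ) (1, 1) (1, 2)
      (e * (2 * p + 2 * q - 6) + k + l) (p * q - 2 + k + l) := by
  have heA : e = 1 ∨ e = 0 ∧ k = 0 := by omega
  have heB : e = 1 ∨ e = 0 ∧ l = 0 := by omega
  obtain ⟨d, rfl⟩ : ∃ d, p = 5 + 2 * d := by
    obtain ⟨m, rfl⟩ := hp
    exact ⟨m - 2, by omega⟩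
  obtain ⟨c, rfl⟩ : ∃ c, q = 3 + 2 * c := by
    obtain ⟨m, rfl⟩ := hq
    exact ⟨m - 1, by omega⟩
  have h5 := hg.fill_above (by omega) hA heA hs' d 5 (by omega) rfl
  have h4 := hg.fill_spine_step (i := 4) (T := ∅) (lt := 0) (ut := 0)
    (U := {x | 5 ≤ x.1 ∧ x.1 ≤ 5 + 2 * d ∧ 0 < x.2 ∧ x.2 ≤ 3 + 2 * c ∧ (5 < x.1 ∨ x.2 ≤ 2)})
    (by omega) hA heA (by omega) (by omega) h5
    (.of_rel (hg.vert 4 2 (by omega) (by omega) (by omega) (by omega))) (by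
      intro x y
      simp only [mem_ofPred_eq, mem_empty_iff_false, false_imp_iff, not_false_eq_true,
        true_and, and_true]
      omega) (by simp only [mem_ofPred_eq]; omega) (by simp only [mem_ofPred_eq]; omega)
  -- Rows `1, 2` and rows `6, 7`, `8, 9`, ... go in pairs; as the number of rows is odd, rows `3, 4,
  -- 5` form a triple.
  have h3 := hg.fill_spine_step (i := 3) (lt := 0)
    (U := {x | 4 ≤ x.1 ∧ x.1 ≤ 5 + 2 * d ∧ 0 < x.2 ∧ x.2 ≤ 3 + 2 * c ∨
      x.1 = 3 ∧ 2 < x.2 ∧ x.2 ≤ 3 + 2 * c})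
    (by omega) hA heA (by omega) (by omega) h4
    (hg.fill_three_rows (by omega) hcorner c 2 (by omega) (by omega)) (by
      intro x y
      simp only [mem_ofPred_eq]
      omega) (by simp only [mem_ofPred_eq]; omega) (by simp only [mem_ofPred_eq]; omega)
  have h2 := hg.fill_spine_step (i := 2) (T := ∅) (lt := 0) (ut := 0)
    (U := {x | 3 ≤ x.1 ∧ x.1 ≤ 5 + 2 * d ∧ 0 < x.2 ∧ x.2 ≤ 3 + 2 * c})
    (by omega) hA heA (by omega) (by omega) h3
    (.of_rel (hg.vert 2 2 (by omega) (by omega) (by omega) (by omega))) (by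
      intro x y
      simp only [mem_ofPred_eq, mem_empty_iff_false, false_imp_iff, not_false_eq_true,
        true_and, and_true]
      omega) (by simp only [mem_ofPred_eq]; omega) (by simp only [mem_ofPred_eq]; omega)
  have hB' := hg.fill_first_rows (by omega) hB heB (1 + 2 * c) 2 (by omega) (by omega) ht'
  rw [if_pos ht] at hB'
  have h1 := hg.fill_spine_step (i := 1)
    (U := {x | 2 ≤ x.1 ∧ x.1 ≤ 5 + 2 * d ∧ 0 < x.2 ∧ x.2 ≤ 3 + 2 * c ∨
      x.1 = 1 ∧ 2 < x.2 ∧ x.2 ≤ 3 + 2 * c ∨ x.1 = 0 ∧ 0 < x.2})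
    (by omega) hA heA le_rfl (by omega) h2
    (hB'.cast (lo' := e * (2 * (1 + 2 * c) + l)) (by rcases heB with rfl | ⟨rfl, rfl⟩ <;> omega) rfl)
    (by
      intro x y
      simp only [mem_ofPred_eq]
      omega) (by simp only [mem_ofPred_eq]; omega) (by simp only [mem_ofPred_eq]; omega)
  rw [if_pos hs] at h1
  refine (h1.mono ?_).cast ?_ ?_
  · rintro ⟨x, y⟩
    simp only [mem_ofPred_eq, mem_compl_iff, mem_insert_iff, mem_singleton_iff, Prod.mk.injEq]
    omega
  · rcases he with rfl | ⟨rfl, rfl, rfl⟩ <;> omega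
  · have : (5 + 2 * d) * (3 + 2 * c) = 2 * (3 + 2 * c) * d + 15 + 10 * c := by ring
    omega

/-- Closing the paths of `fill_all` by the edge from `(1, 2)` to `(1, 1)` gives four ranges of
lengths, according to which detours are used. They overlap enough to leave no gap. -/
theorem hasCycle (hg : TriangulatedGrid r p q) (hp : Odd p) (hp' : 7 ≤ p) (hq : Odd q)
    (hq' : 3 ≤ q) (hqp : q ≤ p) (hcorner : r (4, q - 1) (5, q)) {s t k l n : ℕ} (hs : 1 ≤ s)
    (hs' : s < p) (ht : 2 ≤ t) (ht' : t < q)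
    (hA : PathThrough r {x | 0 < x.1 ∧ x.2 = 0} (s, 1) (s + 1, 1) k)
    (hB : PathThrough r {x | x.1 = 0 ∧ 0 < x.2} (1, t) (1, t + 1) l)
    (hkp : k ≤ p) (hl : 1 ≤ l) (hlq : l ≤ q) (hn : 3 ≤ n) (hn' : n ≤ p * q + k + l) :
    HasCycle r n := by
  have hA₀ : PathThrough r {x | 0 < x.1 ∧ x.2 = 0} (s, 1) (s + 1, 1) 0 :=
    .of_rel (hg.vert s 1 hs hs' le_rfl (by omega))
  have hB₀ : PathThrough r {x | x.1 = 0 ∧ 0 < x.2} (1, t) (1, t + 1) 0 :=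
    .of_rel (hg.horiz 1 t le_rfl (by omega) (by omega) ht')
  have close : ∀ {lo hi : ℕ}, Fill r ({(1, 1), (1, 2)}ᶜ) (1, 1) (1, 2) lo hi →
      lo + 2 ≤ n → n ≤ hi + 2 → HasCycle r n := by
    intro lo hi hF h1 h2
    have h0 : PathThrough r ∅ (1, 2) (1, 1) 0 :=
      .of_rel (hg.symm _ _ (hg.horiz 1 1 le_rfl (by omega) le_rfl (by omega)))
    have := (hF.2 (n - 2) (by omega) (by omega)).hasCycle h0 (by
      intro x
      simp only [mem_compl_iff, mem_insert_iff, mem_singleton_iff, not_or, mem_empty_iff_false]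
      tauto) (by simp)
    convert this using 1
    omega
  have hpq : 3 * p ≤ p * q := by rw [mul_comm]; exact Nat.mul_le_mul_left p hq'
  have hpq' : 7 * q ≤ p * q := Nat.mul_le_mul_right q hp'
  -- With a detour, `2 * p + 2 * q - 4` grid vertices are compulsory; this keeps the shortest such
  -- cycle within the lengths already reached, plus one.
  have hpq'' : 2 * p + 2 * q + p ≤ p * q + 6 := by
    obtain ⟨x, rfl⟩ := Nat.exists_eq_add_of_le hp'
    obtain ⟨y, rfl⟩ := Nat.exists_eq_add_of_le hq'
    nlinarith [Nat.zero_le (x * y)]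
  by_cases h1 : n ≤ p * q
  · exact close (hg.fill_all hp hp' hq hq' hcorner hs hs' ht ht' hA₀ hB₀
      (Or.inr ⟨rfl, rfl, rfl⟩)) (by omega) (by omega)
  by_cases h2 : n ≤ p * q + l
  · exact close (hg.fill_all hp hp' hq hq' hcorner hs hs' ht ht' hA₀ hB
      (Or.inl rfl)) (by omega) (by omega)
  -- Now `n ≥ p * q + 2` because `l ≥ 1`. This is sharp: for `p = k = 7` and `q = 3` the shortest
  -- cycle with only the first detour has `p * q + 2` vertices.
  by_cases h3 : n ≤ p * q + k
  · exact close (hg.fill_all hp hp' hq hq' hcorner hs hs' ht ht' hA hB₀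
      (Or.inl rfl)) (by omega) (by omega)
  · exact close (hg.fill_all hp hp' hq hq' hcorner hs hs' ht ht' hA hB
      (Or.inl rfl)) (by omega) (by omega)

end TriangulatedGrid

end TarsCycles

/-! ### The `3 × 3` grid -/

namespace TarsCycles

open Set

/-- The `3 × 3` grid in which the diagonals cut off the four corners, with detours of length `k`
and `l` outside of the grid. -/
theorem TriangulatedGrid.hasCycle_three {r : ℕ × ℕ → ℕ × ℕ → Prop} (hg : TriangulatedGrid r 3 3)
    (h₁ : r (2, 1) (1, 2)) (h₂ : r (1, 2) (2, 3)) (h₃ : r (2, 3) (3, 2)) (h₄ : r (3, 2) (2, 1))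
    {k l n : ℕ} (hA : PathThrough r {x | 0 < x.1 ∧ x.2 = 0} (2, 1) (3, 1) k)
    (hB : PathThrough r {x | x.1 = 0 ∧ 0 < x.2} (1, 2) (1, 3) l)
    (hB' : PathThrough r {x | x.1 = 0 ∧ 0 < x.2} (1, 1) (1, 3) l)
    (hk : k ≤ 3) (hl : l ≤ 3) (hn : 3 ≤ n) (hn' : n ≤ 9 + k + l) : HasCycle r n := by
  have e12 : r (1, 1) (1, 2) := hg.horiz 1 1 (by omega) (by omega) (by omega) (by omega)
  have e1222 : r (1, 2) (2, 2) := hg.vert 1 2 (by omega) (by omega) (by omega) (by omega)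
  have f1 : Fill r {(2, 2)} (2, 1) (1, 2) 0 1 :=
    Fill.triangle (S₁ := ∅) (S₂ := ∅)
      (.of_rel (hg.horiz 2 1 (by omega) (by omega) (by omega) (by omega)))
      (.of_rel (hg.symm _ _ e1222)) h₁ (by simp) (by simp)
  -- The detour can be entered from `(1, 2)` or from `(1, 1)`, which makes the corner `(1, 1)`
  -- optional.
  have f2 : Fill r ({x | x.1 = 0 ∧ 0 < x.2} ∪ {(1, 1)}) (1, 2) (1, 3) l (l + 1) := by
    refine ⟨by omega, fun j hj hj' => ?_⟩
    rcases (show j = l ∨ j = l + 1 by omega) with rfl | rfl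
    · exact hB.mono subset_union_left
    · have := (PathThrough.of_rel (S := ∅) (hg.symm _ _ e12)).trans hB'
        (S := {x | x.1 = 0 ∧ 0 < x.2} ∪ {(1, 1)}) (by
          rintro ⟨x, y⟩
          simp only [mem_empty_iff_false, false_imp_iff, true_and, mem_ofPred_eq, mem_union,
            mem_singleton_iff, Prod.mk.injEq, ne_eq]
          omega) (by simp)
      simpa using this
  have f3 : Fill r ∅ (1, 3) (2, 3) 0 0 :=
    .of_rel (hg.vert 1 3 (by omega) (by omega) (by omega) (by omega))
  have f4 : Fill r {(3, 3)} (2, 3) (3, 2) 0 1 :=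
    Fill.triangle (S₁ := ∅) (S₂ := ∅)
      (.of_rel (hg.vert 2 3 (by omega) (by omega) (by omega) (by omega)))
      (.of_rel (hg.symm _ _ (hg.horiz 3 2 (by omega) (by omega) (by omega) (by omega))))
      h₃ (by simp) (by simp)
  have f5 : Fill r {(3, 1)} (3, 2) (2, 1) 0 1 :=
    Fill.triangle (S₁ := ∅) (S₂ := ∅)
      (.of_rel (hg.symm _ _ (hg.horiz 3 1 (by omega) (by omega) (by omega) (by omega))))
      (.of_rel (hg.symm _ _ (hg.vert 2 1 (by omega) (by omega) (by omega) (by omega))))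
      h₄ (by simp) (by simp)
  have f6 : Fill r ({x | 0 < x.1 ∧ x.2 = 0} ∪ {(3, 1)}) (3, 2) (2, 1) (k + 1) (k + 1) := by
    refine (Fill.trans (S₁ := ∅) (c := (3, 1)) (.of_rel (hg.symm _ _ (hg.horiz 3 1
      (by omega) (by omega) (by omega) (by omega)))) (hA.symm hg.symm).fill ?_ (by simp)).cast
        (by omega) (by omega)
    rintro ⟨x, y⟩
    simp only [mem_empty_iff_false, false_imp_iff, true_and, mem_ofPred_eq, mem_union,
      mem_singleton_iff, Prod.mk.injEq, ne_eq]
    omega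
  -- The path from `(2, 1)` to `(3, 2)` along the upper side of the grid.
  have upper : ∀ {lo hi : ℕ},
      Fill r ({x | x.1 = 0 ∧ 0 < x.2} ∪ {(1, 1)}) (1, 2) (1, 3) lo hi →
      Fill r {x | x.1 = 0 ∧ 0 < x.2 ∨ x.1 = 1 ∧ 0 < x.2 ∨ x.1 = 2 ∧ 2 ≤ x.2 ∨ x = (3, 3)} (2, 1)
        (3, 2) (lo + 3) (hi + 5) := by
    intro lo hi f
    have g1 := f1.trans f (S := {x | x.1 = 0 ∧ 0 < x.2 ∨ x = (1, 1) ∨ x = (1, 2) ∨ x = (2, 2)}) (by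
      rintro ⟨x, y⟩
      simp only [mem_ofPred_eq, mem_union, mem_singleton_iff, Prod.mk.injEq, ne_eq]
      omega) (by simp)
    have g2 := f3.trans f4 (S := {x | x = (2, 3) ∨ x = (3, 3)}) (by simp) (by simp)
    refine (g1.trans g2 ?_ ?_).cast (by omega) (by omega)
    · rintro ⟨x, y⟩
      simp only [mem_ofPred_eq, Prod.mk.injEq, ne_eq]
      omega
    · simp
  have close : ∀ {lo hi lo' hi' : ℕ}, Fill r {x | x.1 = 0 ∧ 0 < x.2 ∨ x.1 = 1 ∧ 0 < x.2 ∨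
      x.1 = 2 ∧ 2 ≤ x.2 ∨ x = (3, 3)} (2, 1) (3, 2) lo hi →
      Fill r ({x | 0 < x.1 ∧ x.2 = 0} ∪ {(3, 1)}) (3, 2) (2, 1) lo' hi' →
      lo + lo' + 2 ≤ n → n ≤ hi + hi' + 2 → HasCycle r n := by
    rintro lo hi lo' hi' ⟨g, F⟩ ⟨g', F'⟩ h1 h2
    obtain ⟨i, hi1, hi2⟩ : ∃ i, max lo (n - 2 - hi') = i ∧ i ≤ hi := ⟨_, rfl, by omega⟩
    have := (F i (by omega) hi2).hasCycle (F' (n - 2 - i) (by omega) (by omega)) (by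
      rintro ⟨x, y⟩
      simp only [mem_ofPred_eq, mem_union, mem_singleton_iff, Prod.mk.injEq, ne_eq]
      omega) (by simp)
    convert this using 1
    omega
  -- The general construction uses at least five vertices. Length `3` is a triangle with the centre,
  -- length `4` the cycle of the four diagonals.
  rcases (show n = 3 ∨ n = 4 ∨ 5 ≤ n by omega) with rfl | rfl | hn5
  · exact (PathThrough.of_rel (S := ∅) h₁).hasCycle (f1.symm hg.symm |>.2 1 (by omega) le_rfl)
      (by simp) (by simp)
  · have g1 := (PathThrough.of_rel (S := ∅) h₁).trans (S := {(1, 2)})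
      (PathThrough.of_rel (S := ∅) h₂) (by simp) (by simp)
    have g2 := (PathThrough.of_rel (S := ∅) h₃).trans (S := {(3, 2)})
      (PathThrough.of_rel (S := ∅) h₄) (by simp) (by simp)
    exact g1.hasCycle g2 (by simp; omega) (by simp)
  by_cases hA1 : n ≤ 8
  · exact close (upper (.of_rel (hg.horiz 1 2 (by omega) (by omega) (by omega) (by omega))))
      (f5.mono subset_union_right) (by omega) (by omega)
  by_cases hA2 : n ≤ 9 + l
  · exact close (upper f2) (f5.mono subset_union_right) (by omega) (by omega)
  · exact close (upper f2) f6 (by omega) (by omega)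

end TarsCycles

/-! ### Gray codes -/

namespace TarsCycles

open Set SimpleGraph

variable {V : Type*}

/-- The binary reflected Gray code: all subsets of a list, each obtained from its predecessor by
adding or deleting a single element. -/
def gray : List V → List (Set V)
  | [] => [∅]
  | x :: l => gray l ++ (gray l).reverse.map (insert x)

theorem tarAdj_insert_right {X : Set V} {w : V} (hw : w ∉ X) : TARAdj X (insert w X) :=
  Or.inl ⟨w, hw, rfl⟩

theorem tarAdj_exists_insert {X Y : Set V} (h : TARAdj X Y) :
    (∃ w, w ∉ X ∧ Y = insert w X) ∨ ∃ w, w ∉ Y ∧ X = insert w Y :=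
  h.imp_right fun ⟨w, hw, hY⟩ => ⟨w, by simp [hY], by simp [hY, hw]⟩

theorem tarAdj_insert_insert {X Y : Set V} {x : V} (hX : x ∉ X) (hY : x ∉ Y) (h : TARAdj X Y) :
    TARAdj (insert x X) (insert x Y) := by
  have key : ∀ {X : Set V} {w : V}, x ∉ insert w X → w ∉ X →
      TARAdj (Insert.insert x X) (Insert.insert x (Insert.insert w X)) := by
    intro X w hx hw
    rw [Set.insert_comm]
    refine tarAdj_insert_right ?_
    simp only [mem_insert_iff, not_or] at hx ⊢
    exact ⟨fun h => hx.1 h.symm, hw⟩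
  rcases tarAdj_exists_insert h with ⟨w, hw, rfl⟩ | ⟨w, hw, rfl⟩
  · exact key hY hw
  · exact SimpleGraph.TARAdj.symm (key hX hw)

theorem mem_gray {l : List V} {X : Set V} : X ∈ gray l ↔ X ⊆ {x | x ∈ l} := by
  induction l generalizing X with
  | nil => simp [gray, Set.subset_def, Set.eq_empty_iff_forall_notMem]
  | cons x l ih =>
    simp only [gray, List.mem_append, List.mem_map, List.mem_reverse, ih]
    constructor
    · rintro (h | ⟨Y, hY, rfl⟩)
      · exact fun y hy => List.mem_cons_of_mem _ (h hy)
      · rintro y (rfl | hy)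
        · exact List.mem_cons_self
        · exact List.mem_cons_of_mem _ (hY hy)
    · intro h
      by_cases hx : x ∈ X
      · refine Or.inr ⟨X \ {x}, ?_, by simp [hx]⟩
        rintro y ⟨hy, hyx⟩
        exact (List.mem_cons.1 (h hy)).resolve_left hyx
      · refine Or.inl fun y hy => (List.mem_cons.1 (h hy)).resolve_left ?_
        rintro rfl
        exact hx hy

theorem gray_eq_cons (l : List V) : ∃ t, gray l = ∅ :: t := by
  induction l with
  | nil => exact ⟨[], rfl⟩
  | cons x l ih =>
    obtain ⟨t, ht⟩ := ih
    rw [gray, ht]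
    exact ⟨_, rfl⟩

theorem getLast?_gray_cons (x : V) (l : List V) : (gray (x :: l)).getLast? = some {x} := by
  obtain ⟨t, ht⟩ := gray_eq_cons l
  simp [gray, ht, List.getLast?_cons]

theorem nodup_gray {l : List V} (hl : l.Nodup) : (gray l).Nodup := by
  induction l with
  | nil => simp [gray]
  | cons x l ih =>
    rw [List.nodup_cons] at hl
    have hmem : ∀ Y ∈ gray l, x ∉ Y := fun Y hY hx => hl.1 (mem_gray.1 hY hx)
    rw [gray, List.nodup_append]
    refine ⟨ih hl.2, ?_, ?_⟩
    · refine List.Nodup.map_on ?_ (List.nodup_reverse.2 (ih hl.2))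
      intro Y hY Z hZ h
      have := congrArg (· \ {x}) h
      simpa [hmem Y (by simpa using hY), hmem Z (by simpa using hZ)] using this
    · intro Y hY Z hZ h
      obtain ⟨Z, -, rfl⟩ := List.mem_map.1 hZ
      exact hmem Y hY (h ▸ Set.mem_insert x Z)

theorem isChain_gray {l : List V} (hl : l.Nodup) : (gray l).IsChain TARAdj := by
  induction l with
  | nil => simp [gray]
  | cons x l ih =>
    rw [List.nodup_cons] at hl
    have hmem : ∀ Y ∈ gray l, x ∉ Y := fun Y hY hx => hl.1 (mem_gray.1 hY hx)
    rw [gray, List.isChain_append]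
    refine ⟨ih hl.2, ?_, ?_⟩
    · rw [List.isChain_map, List.isChain_reverse]
      exact (ih hl.2).imp_of_mem_imp fun Y Z hY hZ h => (tarAdj_insert_insert (hmem Y hY) (hmem Z hZ) h).symm
    · intro Y hY Z hZ
      simp only [List.head?_map, List.head?_reverse, Option.mem_def, Option.map_eq_some_iff] at hZ hY
      obtain ⟨Z, hZ, rfl⟩ := hZ
      obtain rfl : Y = Z := by rw [hY] at hZ; exact Option.some.inj hZ
      exact tarAdj_insert_right (hmem Y (List.mem_of_getLast? hY))

/-- The first positions of the code thus depend only on the last letters of the list. -/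
theorem gray_prefix (l m : List V) : gray m <+: gray (l ++ m) := by
  induction l with
  | nil => exact List.prefix_rfl
  | cons x l ih => exact ih.trans (List.prefix_append _ _)

/-- Each new letter is inserted into a reversed copy of the code, so the two sets stay neighbours
but swap their order; hence the disjunction. -/
theorem infix_gray (l : List V) (v : V) (hv : v ∉ l) :
    [{x | x ∈ l ++ [v]}, {x | x ∈ l}] <:+: gray (l ++ [v]) ∨
    [{x | x ∈ l}, {x | x ∈ l ++ [v]}] <:+: gray (l ++ [v]) := by
  induction l with
  | nil => right; simp [gray]
  | cons x l ih =>
    have key : ∀ {A B : Set V}, [A, B] <:+: gray (l ++ [v]) →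
        [Insert.insert x B, Insert.insert x A] <:+: gray (x :: l ++ [v]) := by
      intro A B h
      have := ((List.reverse_infix.2 h).map (Insert.insert x))
      exact (by simpa using this : _ <:+: ((gray (l ++ [v])).reverse.map (Insert.insert x))).trans
        (List.suffix_append _ _).isInfix
    have e : ∀ m : List V, {y | y ∈ x :: m} = Insert.insert x {y | y ∈ m} := by
      intro m; ext y; simp
    rw [List.cons_append, e, e]
    exact (ih fun h => hv (List.mem_cons_of_mem _ h)).symm.imp key key

/-- The position of a set in a Gray code that begins with `∅, {v}`, ends with a singleton, and
in which the whole set and the complement of `v` are neighbours. -/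
structure IsGrayIndex (v : V) (γ : Set V → ℕ) : Prop where
  injective : Function.Injective γ
  lt : ∀ X, γ X < 2 ^ Nat.card V
  surj : ∀ i < 2 ^ Nat.card V, ∃ X, γ X = i
  map_empty : γ ∅ = 0
  tarAdj : ∀ X Y, γ Y = γ X + 1 → TARAdj X Y
  map_singleton : γ {v} = 1
  map_last : ∃ x, γ {x} = 2 ^ Nat.card V - 1
  univ_adj : γ univ = γ (univ \ {v}) + 1 ∨ γ (univ \ {v}) = γ univ + 1
  exists_insert : 3 ≤ Nat.card V → ∀ X Y, γ X = 4 → γ Y = 5 → ∃ w, w ∉ X ∧ Y = insert w X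

/-- Take the Gray code of a list of all vertices with `v` placed last. -/
theorem exists_isGrayIndex [Finite V] (v : V) : ∃ γ : Set V → ℕ, IsGrayIndex v γ := by
  classical
  have := Fintype.ofFinite V
  obtain ⟨l, hl, hl'⟩ : ∃ l : List V, (l ++ [v]).Nodup ∧ ∀ x, x ∈ l ++ [v] := by
    refine ⟨(Finset.univ.erase v).toList, ?_, ?_⟩
    · rw [List.nodup_append]
      refine ⟨Finset.nodup_toList _, by simp, ?_⟩
      intro x hx y hy hxy
      simp at hx hy
      exact hx (hxy.trans hy)
    · intro x
      by_cases h : x = v <;> simp [h]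
  set L := gray (l ++ [v]) with hL
  have hLn : L.Nodup := nodup_gray hl
  have hLm : ∀ X, X ∈ L := fun X => mem_gray.2 fun x _ => hl' x
  have hLc : L.IsChain TARAdj := isChain_gray hl
  have hlen : L.length = 2 ^ Nat.card V := by
    rw [← List.toFinset_card_of_nodup hLn, Finset.eq_univ_of_forall (s := L.toFinset)
      (fun X => List.mem_toFinset.2 (hLm X)), Finset.card_univ, Fintype.card_set,
      Nat.card_eq_fintype_card]
  have hidx : ∀ i (h : i < L.length), L.idxOf L[i] = i := fun i h => hLn.idxOf_getElem i h
  have hget : ∀ X, ∃ h : L.idxOf X < L.length, L[L.idxOf X] = X := fun X =>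
    ⟨List.idxOf_lt_length_iff.2 (hLm X), List.getElem_idxOf _⟩
  have hinfix : ∀ {A B : Set V}, [A, B] <:+: L → L.idxOf B = L.idxOf A + 1 := by
    rintro A B ⟨s, t, h⟩
    have h1 : L[s.length]? = some A := by rw [← h]; simp
    have h2 : L[s.length + 1]? = some B := by rw [← h]; simp
    obtain ⟨h1, rfl⟩ := List.getElem?_eq_some_iff.1 h1
    obtain ⟨h2, rfl⟩ := List.getElem?_eq_some_iff.1 h2
    rw [hidx, hidx]
  have hpre : ∀ m X i, m <:+ l ++ [v] → (gray m)[i]? = some X → L.idxOf X = i := by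
    rintro m X i ⟨s, h⟩ hX
    have := gray_prefix s m
    rw [h] at this
    obtain ⟨h1, h2⟩ := List.getElem?_eq_some_iff.1 hX
    have h3 : L[i]? = some X :=
      (List.prefix_iff_getElem?.1 this i h1).trans (congrArg some h2)
    obtain ⟨h1, rfl⟩ := List.getElem?_eq_some_iff.1 h3
    exact hidx _ _
  refine ⟨fun X => L.idxOf X, ?_, ?_, ?_, ?_, ?_, ?_, ?_, ?_, ?_⟩
  · intro X Y h
    exact (List.idxOf_inj (hLm X)).1 h
  · intro X
    rw [← hlen]
    exact (hget X).1
  · intro i hi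
    exact ⟨L[i], hidx _ _⟩
  · exact hpre [v] ∅ 0 (List.suffix_append _ _) rfl
  · intro X Y h
    obtain ⟨h1, h2⟩ := hget X
    obtain ⟨h3, h4⟩ := hget Y
    have := List.isChain_iff_getElem.1 hLc (L.idxOf X) (by omega)
    rw [h2] at this
    simp only [← h] at this
    rwa [h4] at this
  · exact hpre [v] {v} 1 (List.suffix_append _ _) (by simp [gray])
  · obtain ⟨x, m, hm⟩ : ∃ x m, l ++ [v] = x :: m := by
      cases l with
      | nil => exact ⟨v, [], rfl⟩
      | cons x l => exact ⟨x, l ++ [v], rfl⟩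
    refine ⟨x, ?_⟩
    have h1 := getLast?_gray_cons x m
    rw [← hm, List.getLast?_eq_getElem?] at h1
    obtain ⟨h1, h2⟩ := List.getElem?_eq_some_iff.1 h1
    rw [← h2, ← hlen]
    exact hidx _ _
  · have h1 : {x | x ∈ l ++ [v]} = (univ : Set V) := Set.eq_univ_of_forall hl'
    have hv : v ∉ l := fun h => (List.nodup_append.1 hl).2.2 v h v (by simp) rfl
    have h2 : {x | x ∈ l} = (univ : Set V) \ {v} := by
      ext x
      have := hl' x
      simp only [List.mem_append, List.mem_singleton] at this
      simp only [mem_ofPred_eq, mem_sdiff, mem_univ, true_and, mem_singleton_iff]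
      refine ⟨?_, this.resolve_right⟩
      rintro h rfl
      exact hv h
    have h3 := infix_gray l v hv
    rw [h1, h2] at h3
    exact (h3.imp hinfix hinfix).symm
  · intro h3 X Y hX hY
    have hll : l.length + 1 = Nat.card V := by
      rw [Nat.card_eq_fintype_card, ← Finset.card_univ, ← Finset.eq_univ_of_forall
        (s := (l ++ [v]).toFinset) (fun X => List.mem_toFinset.2 (hl' X)),
        List.toFinset_card_of_nodup hl]
      simp
    obtain ⟨s, c, b, rfl⟩ : ∃ s c b, l = s ++ [c, b] := by
      obtain ⟨l', b, rfl⟩ := List.eq_nil_or_concat l |>.resolve_left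
        (by rintro rfl; rw [List.length_nil] at hll; omega)
      obtain ⟨s, c, rfl⟩ := List.eq_nil_or_concat l' |>.resolve_left
        (by rintro rfl; simp only [List.length_nil, List.length_cons, List.nil_append, List.concat_eq_append] at hll; omega)
      exact ⟨s, c, b, by simp⟩
    -- The code of `[c, b, v]` runs `∅, {v}, {b, v}, {b}, {c, b}, {c, b, v}, ...`, so passing from
    -- position `4` to `5` inserts `v`.
    have hcb : [c, b, v] <:+ s ++ [c, b] ++ [v] := ⟨s, by simp⟩
    have h4 := hpre [c, b, v] {c, b} 4 hcb (by simp [gray])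
    have h5 := hpre [c, b, v] {c, b, v} 5 hcb (by simp [gray])
    obtain rfl : X = {c, b} := (List.idxOf_inj (hLm X)).1 (hX.trans h4.symm)
    obtain rfl : Y = {c, b, v} := (List.idxOf_inj (hLm Y)).1 (hY.trans h5.symm)
    have hv : v ∉ s ++ [c, b] := fun h => (List.nodup_append.1 hl).2.2 v h v (by simp) rfl
    refine ⟨v, fun h => hv ?_, ?_⟩
    · simp only [mem_insert_iff, mem_singleton_iff] at h
      simp [h]
    · ext y
      simp only [mem_insert_iff, mem_singleton_iff]
      tauto

end TarsCycles

/-! ### Pancyclicity as a statement about lists, and Hamiltonian paths from the full set -/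

namespace TarsCycles

open Set SimpleGraph

section

variable {α β : Type*} {r : α → α → Prop} {k : ℕ}

theorem HasCycle.map {s : β → β → Prop} {f : α → β} (hf : Function.Injective f)
    (hrs : ∀ x y, r x y → s (f x) (f y)) (h : HasCycle r k) : HasCycle s k := by
  obtain ⟨a, l, h1, h2, h3⟩ := h
  refine ⟨f a, l.map f, by simpa, by simpa using h2.map hf, ?_⟩
  simpa using List.isChain_map_of_isChain f hrs h3

theorem exists_rotation {a x : α} {l : List α} (hl : (a :: (l ++ [a])).IsChain r)
    (hx : x ∈ a :: l) : ∃ m : List α, (x :: m).Perm (a :: l) ∧ (x :: (m ++ [x])).IsChain r := by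
  rcases List.mem_cons.1 hx with rfl | hx
  · exact ⟨l, .refl _, hl⟩
  · obtain ⟨s, t, rfl⟩ := List.append_of_mem hx
    have e : a :: (s ++ x :: t ++ [a]) = (a :: s) ++ x :: (t ++ [a]) := by simp
    rw [e, List.isChain_split] at hl
    refine ⟨t ++ a :: s, ?_, ?_⟩
    · have : x :: (t ++ a :: s) = (x :: t) ++ (a :: s) := by simp
      rw [this, ← List.cons_append]
      exact List.perm_append_comm
    · have e : x :: (t ++ a :: s ++ [x]) = (x :: t) ++ a :: (s ++ [x]) := by simp
      rw [e, List.isChain_split]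
      exact ⟨by simpa using hl.2, by simpa using hl.1⟩

theorem exists_walk_support_eq {Γ : SimpleGraph α} {a b : α} {l : List α} (hne : l ≠ [])
    (hl : l.IsChain Γ.Adj) (ha : l.head hne = a) (hb : l.getLast hne = b) :
    ∃ p : Γ.Walk a b, p.support = l := by
  subst ha hb
  exact ⟨_, Walk.support_ofSupport hne hl⟩

theorem exists_isCycle_iff {Γ : SimpleGraph α} (hk : 3 ≤ k) :
    (∃ (x : α) (p : Γ.Walk x x), p.IsCycle ∧ p.length = k) ↔ HasCycle Γ.Adj k := by
  constructor
  · rintro ⟨x, p, hp, rfl⟩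
    cases p with
    | nil => simp at hk
    | cons h q =>
      have hq : q.support = q.support.dropLast ++ [x] := by
        conv_lhs => rw [← List.dropLast_append_getLast q.support_ne_nil, Walk.getLast_support]
      refine ⟨x, q.support.dropLast, ?_, ?_, ?_⟩
      · simp
      · have := hp.nodup_dropLast_support
        rwa [Walk.support_cons, List.dropLast_cons_of_ne_nil q.support_ne_nil] at this
      · rw [← hq]
        exact (Walk.cons h q).isChain_adj_support
  · rintro ⟨a, l, rfl, h2, h3⟩
    obtain ⟨p, hp⟩ := exists_walk_support_eq (a := a) (b := a) (List.cons_ne_nil _ _) h3 rfl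
      (by simp)
    have hlen : p.length = l.length + 1 := by
      have := congrArg List.length hp
      simpa using this
    refine ⟨a, p, ?_, hlen⟩
    rw [Walk.isCycle_iff_isPath_tail_and_le_length]
    refine ⟨?_, by omega⟩
    rw [Walk.isPath_def, Walk.support_tail_of_not_nil _ (fun hn => by simp [hn.length_eq_zero] at hlen),
      hp, List.tail_cons]
    rw [List.nodup_cons] at h2
    exact List.nodup_append.2 ⟨h2.2, by simp, fun x hx y hy h => by
      rw [List.mem_singleton] at hy
      exact h2.1 (hy ▸ h ▸ hx)⟩

end

variable {V W : Type*} {G : SimpleGraph V} {H : SimpleGraph W} {X Y : Set V}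

/-- Adjacency of dominating sets, as a relation between sets of vertices. -/
def TarsRel (G : SimpleGraph V) (X Y : Set V) : Prop :=
  G.IsDominatingSet X ∧ G.IsDominatingSet Y ∧ (TARAdj X Y ∨ TSAdj G X Y)

theorem TarsRel.symm (h : TarsRel G X Y) : TarsRel G Y X :=
  ⟨h.2.1, h.1, h.2.2.imp TARAdj.symm TSAdj.symm⟩

theorem isPancyclic_tarsGraph_iff [Finite V] : G.tarsGraph.IsPancyclic ↔
    ∀ k, 3 ≤ k → k ≤ Nat.card {X // G.IsDominatingSet X} → HasCycle (TarsRel G) k := by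
  have e : TarsRel G = Relation.Map G.tarsGraph.Adj Subtype.val Subtype.val := by
    ext X Y
    constructor
    · rintro ⟨hX, hY, h⟩
      exact ⟨⟨X, hX⟩, ⟨Y, hY⟩, h, rfl, rfl⟩
    · rintro ⟨⟨X, hX⟩, ⟨Y, hY⟩, h, rfl, rfl⟩
      exact ⟨hX, hY, h⟩
  refine forall_congr' fun k => forall_congr' fun hk => forall_congr' fun _ => ?_
  rw [exists_isCycle_iff hk]
  constructor
  · exact HasCycle.map Subtype.val_injective fun X Y h => ⟨X.2, Y.2, h⟩
  · rw [e]
    exact HasCycle.of_map Subtype.val_injective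

theorem isDominatingSet_image (e : G ≃g H) (hX : G.IsDominatingSet X) :
    H.IsDominatingSet (e '' X) := by
  intro w
  rcases hX (e.symm w) with h | ⟨x, hx, h⟩
  · exact Or.inl ⟨_, h, by simp⟩
  · refine Or.inr ⟨e x, ⟨x, hx, rfl⟩, ?_⟩
    rw [← e.map_adj_iff] at h
    simpa using h

theorem tarsRel_image (e : G ≃g H) (h : TarsRel G X Y) : TarsRel H (e '' X) (e '' Y) := by
  refine ⟨isDominatingSet_image e h.1, isDominatingSet_image e h.2.1, h.2.2.imp ?_ ?_⟩
  · rintro (⟨w, hw, rfl⟩ | ⟨w, hw, rfl⟩)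
    · exact Or.inl ⟨e w, by simpa using hw, image_insert_eq⟩
    · exact Or.inr ⟨e w, by simpa using hw, by rw [image_sdiff e.injective]; simp⟩
  · rintro ⟨a, ha, b, hb, hab, rfl⟩
    refine ⟨e a, by simpa using ha, e b, by simpa using hb, e.map_adj_iff.2 hab, ?_⟩
    rw [image_sdiff e.injective, image_union]
    simp

theorem IsPancyclic.tars_iso [Finite V] [Finite W] (e : G ≃g H) (h : G.tarsGraph.IsPancyclic) :
    H.tarsGraph.IsPancyclic := by
  rw [isPancyclic_tarsGraph_iff] at h ⊢
  intro k hk hk'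
  refine (h k hk (hk'.trans ?_)).map (image_injective.2 e.injective) fun X Y => tarsRel_image e
  refine Nat.card_le_card_of_injective
    (fun X => ⟨e.symm '' X.1, isDominatingSet_image e.symm X.2⟩) fun X Y hXY => ?_
  exact Subtype.ext (image_injective.2 e.symm.injective (Subtype.ext_iff.1 hXY))

theorem isDominatingSet_univ : G.IsDominatingSet univ := fun _ => Or.inl (mem_univ _)

theorem IsDominatingSet.mono (h : G.IsDominatingSet X) (hXY : X ⊆ Y) : G.IsDominatingSet Y :=
  fun w => (h w).imp (fun h => hXY h) fun ⟨x, hx, hxw⟩ => ⟨x, hXY hx, hxw⟩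

/-- Adding or sliding a token needs a free vertex. This pins down the last vertex of a Hamiltonian
path obtained by opening a cycle at `univ`. -/
theorem exists_of_tarsRel_univ (h : TarsRel G univ X) : ∃ v, X = univ \ {v} := by
  rcases h.2.2 with (⟨w, hw, -⟩ | ⟨w, -, h⟩) | ⟨a, -, b, ⟨-, hb⟩, -⟩
  · exact absurd (mem_univ w) hw
  · exact ⟨w, h⟩
  · exact absurd (mem_univ b) hb

/-- If the TARS-graph is pancyclic, then it has a Hamiltonian path that starts at the whole vertex
set and ends at the complement of a single vertex, unless the former is its only vertex. -/
theorem exists_dominating_path [Finite V] (h : G.tarsGraph.IsPancyclic) :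
    ∃ l : List (Set V), (univ :: l).Nodup ∧ (univ :: l).IsChain (TarsRel G) ∧
      (∀ X ∈ univ :: l, G.IsDominatingSet X) ∧
      l.length + 1 = Nat.card {X // G.IsDominatingSet X} ∧
      (l = [] ∨ ∃ v, l.getLast? = some (univ \ {v})) := by
  classical
  rw [isPancyclic_tarsGraph_iff] at h
  set N := Nat.card {X // G.IsDominatingSet X} with hN
  have hpos : 0 < N := by
    have : Nonempty {X // G.IsDominatingSet X} := ⟨⟨univ, isDominatingSet_univ⟩⟩
    exact Nat.card_pos
  -- Pancyclicity says nothing about fewer than three vertices, so those cases are done by hand.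
  rcases (show N = 1 ∨ N = 2 ∨ 3 ≤ N by omega) with h1 | h2 | h3
  · exact ⟨[], by simp, by simp, by simp [isDominatingSet_univ], by simp [h1], Or.inl rfl⟩
  · obtain ⟨⟨X, hX⟩, hne⟩ : ∃ X : {X // G.IsDominatingSet X}, X ≠ ⟨univ, isDominatingSet_univ⟩ := by
      by_contra! hc
      have : Subsingleton {X // G.IsDominatingSet X} := ⟨fun X Y => (hc X).trans (hc Y).symm⟩
      have := Finite.card_le_one_iff_subsingleton.2 this
      omega
    obtain ⟨v, hv⟩ : ∃ v, v ∉ X := by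
      by_contra! hc
      exact hne (Subtype.ext (Set.eq_univ_of_forall hc))
    have hd : G.IsDominatingSet (univ \ {v}) :=
      IsDominatingSet.mono hX fun x hx => ⟨mem_univ x, fun h => hv (h ▸ hx)⟩
    refine ⟨[univ \ {v}], ?_, ?_, by simp [isDominatingSet_univ, hd], by simp [h2], Or.inr ⟨v, rfl⟩⟩
    · simp only [List.nodup_cons, List.mem_singleton, List.not_mem_nil, not_false_eq_true,
        List.nodup_nil, and_self, and_true]
      intro h
      exact (h ▸ mem_univ v : v ∈ univ \ {v}).2 rfl
    · rw [List.isChain_pair]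
      exact ⟨isDominatingSet_univ, hd, Or.inl (Or.inr ⟨v, mem_univ v, rfl⟩)⟩
  · obtain ⟨a, l, hl, hnd, hc⟩ := h N h3 le_rfl
    have hdom : ∀ X ∈ a :: l, G.IsDominatingSet X := fun X hX =>
      (exists_rel_of_mem_cycle hc hX).choose_spec.1
    have hu : univ ∈ a :: l := by
      have e : (((a :: l).toFinset : Finset (Set V)) : Set (Set V)) = {X | G.IsDominatingSet X} := by
        refine Set.eq_of_subset_of_ncard_le (fun X hX => hdom X (by simpa using hX)) ?_ (toFinite _)
        rw [Set.ncard_coe_finset, List.toFinset_card_of_nodup hnd, List.length_cons, hl]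
        exact le_rfl
      have : univ ∈ {X | G.IsDominatingSet X} := isDominatingSet_univ
      rw [← e] at this
      simpa using this
    obtain ⟨m, hm, hmc⟩ := exists_rotation hc hu
    have hlen := hm.length_eq
    simp only [List.length_cons] at hlen
    refine ⟨m, hm.nodup_iff.2 hnd, ?_, fun X hX => hdom X (hm.mem_iff.1 hX), by omega, ?_⟩
    · rw [← List.cons_append] at hmc
      exact hmc.left_of_append
    · rcases List.eq_nil_or_concat m with rfl | ⟨t, X, rfl⟩
      · exact Or.inl rfl
      · refine Or.inr ?_
        have : TarsRel G X univ := by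
          have e : univ :: ((t.concat X) ++ [univ]) = (univ :: t) ++ [X, univ] := by simp
          rw [e] at hmc
          exact List.isChain_pair.1 hmc.right_of_append
        obtain ⟨v, hv⟩ := exists_of_tarsRel_univ this.symm
        exact ⟨v, by simp [hv]⟩

end TarsCycles

/-! ### Dominating sets of a join -/

namespace TarsCycles

open Set SimpleGraph

theorem PathThrough.of_list {α : Type*} {r : α → α → Prop} {S : Set α} {a b : α} {l : List α}
    (hne : l ≠ []) (hnd : l.Nodup) (hS : ∀ x ∈ l, x ∈ S) (hc : l.IsChain r)
    (ha : ∀ x ∈ l.head?, r a x) (hb : ∀ x ∈ l.getLast?, r x b) :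
    PathThrough r S a b l.length := by
  refine ⟨l, rfl, hnd, hS, ?_⟩
  refine List.IsChain.cons (hc.append (List.isChain_singleton b) ?_) ?_
  · intro x hx y hy
    simp only [List.head?_cons, Option.mem_def, Option.some.injEq] at hy
    exact hy ▸ hb x hx
  · intro y hy
    rw [List.head?_append_of_ne_nil _ hne] at hy
    exact ha y hy

variable {V : Type u} {W : Type v} {G : SimpleGraph V} {H : SimpleGraph W}
  {X X' : Set V} {Y Y' : Set W}

/-- The disjoint union of a set of vertices of one graph and a set of vertices of another. -/
def sumSet (x : Set V × Set W) : Set (V ⊕ W) := {z | z.elim (· ∈ x.1) (· ∈ x.2)}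

@[simp] theorem inl_mem_sumSet {x : Set V × Set W} {a : V} :
    Sum.inl a ∈ sumSet x ↔ a ∈ x.1 := Iff.rfl

@[simp] theorem inr_mem_sumSet {x : Set V × Set W} {a : W} :
    Sum.inr a ∈ sumSet x ↔ a ∈ x.2 := Iff.rfl

theorem sumSet_injective : Function.Injective (sumSet : Set V × Set W → Set (V ⊕ W)) := by
  rintro ⟨X, Y⟩ ⟨X', Y'⟩ h
  refine Prod.ext (Set.ext fun a => ?_) (Set.ext fun a => ?_)
  · exact Set.ext_iff.1 h (Sum.inl a)
  · exact Set.ext_iff.1 h (Sum.inr a)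

theorem sumSet_surjective : Function.Surjective (sumSet : Set V × Set W → Set (V ⊕ W)) := by
  intro Z
  refine ⟨(Sum.inl ⁻¹' Z, Sum.inr ⁻¹' Z), ?_⟩
  ext (a | a) <;> simp

@[simp] theorem join_adj_inl_inl {a b : V} :
    (G.join H).Adj (Sum.inl a) (Sum.inl b) ↔ G.Adj a b := by simp [SimpleGraph.join]

@[simp] theorem join_adj_inr_inr {a b : W} :
    (G.join H).Adj (Sum.inr a) (Sum.inr b) ↔ H.Adj a b := by simp [SimpleGraph.join]

@[simp] theorem join_adj_inl_inr {a : V} {b : W} :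
    (G.join H).Adj (Sum.inl a) (Sum.inr b) := by simp [SimpleGraph.join]

@[simp] theorem join_adj_inr_inl {a : W} {b : V} :
    (G.join H).Adj (Sum.inr a) (Sum.inl b) := by simp [SimpleGraph.join]

/-- The join is commutative. -/
def joinComm (G : SimpleGraph V) (H : SimpleGraph W) : G.join H ≃g H.join G where
  toEquiv := Equiv.sumComm V W
  map_rel_iff' := by rintro (a | a) (b | b) <;> simp

/-- A pair of sets whose disjoint union dominates the join. -/
def Dom (G : SimpleGraph V) (H : SimpleGraph W) (x : Set V × Set W) : Prop :=
  (G.join H).IsDominatingSet (sumSet x)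

/-- Adjacency in the TARS-graph of the join, for pairs of sets. -/
def JoinRel (G : SimpleGraph V) (H : SimpleGraph W) (x y : Set V × Set W) : Prop :=
  TarsRel (G.join H) (sumSet x) (sumSet y)

theorem JoinRel.symm {x y : Set V × Set W} (h : JoinRel G H x y) : JoinRel G H y x :=
  TarsRel.symm h

theorem image_swap_sumSet (x : Set V × Set W) : joinComm G H '' sumSet x = sumSet x.swap := by
  ext (a | a)
  · simp [joinComm, Equiv.sumComm]
  · simp [joinComm, Equiv.sumComm]

theorem Dom.swap {x : Set V × Set W} (h : Dom G H x) : Dom H G x.swap := by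
  have := isDominatingSet_image (joinComm G H) h
  rwa [image_swap_sumSet] at this

theorem JoinRel.swap {x y : Set V × Set W} (h : JoinRel G H x y) :
    JoinRel H G x.swap y.swap := by
  have := tarsRel_image (joinComm G H) h
  rwa [image_swap_sumSet, image_swap_sumSet] at this

theorem dom_of_nonempty (hX : X.Nonempty) (hY : Y.Nonempty) : Dom G H (X, Y) := by
  obtain ⟨a, ha⟩ := hX
  obtain ⟨b, hb⟩ := hY
  rintro (z | z)
  · exact Or.inr ⟨Sum.inr b, hb, by simp⟩
  · exact Or.inr ⟨Sum.inl a, ha, by simp⟩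

theorem nonempty_of_isDominatingSet [Nonempty V] (hX : G.IsDominatingSet X) : X.Nonempty := by
  obtain ⟨v⟩ := ‹Nonempty V›
  rcases hX v with h | ⟨x, hx, -⟩
  exacts [⟨v, h⟩, ⟨x, hx⟩]

theorem dom_left [Nonempty V] (hX : G.IsDominatingSet X) : Dom G H (X, ∅) := by
  obtain ⟨a, ha⟩ := nonempty_of_isDominatingSet hX
  rintro (z | z)
  · rcases hX z with h | ⟨x, hx, h⟩
    · exact Or.inl h
    · exact Or.inr ⟨Sum.inl x, hx, by simpa⟩
  · exact Or.inr ⟨Sum.inl a, ha, by simp⟩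

theorem dom_right [Nonempty W] (hY : H.IsDominatingSet Y) : Dom G H (∅, Y) :=
  (dom_left (H := G) hY).swap

theorem Dom.cases {x : Set V × Set W} (h : Dom G H x) : x.1.Nonempty ∧ x.2.Nonempty ∨
    G.IsDominatingSet x.1 ∧ x.2 = ∅ ∨ x.1 = ∅ ∧ H.IsDominatingSet x.2 := by
  obtain ⟨X, Y⟩ := x
  rcases Y.eq_empty_or_nonempty with rfl | hY
  · refine Or.inr (Or.inl ⟨fun w => ?_, rfl⟩)
    rcases h (Sum.inl w) with h | ⟨z | z, hz, h⟩
    · exact Or.inl h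
    · exact Or.inr ⟨z, hz, by simpa using h⟩
    · exact absurd hz (by simp)
  rcases X.eq_empty_or_nonempty with rfl | hX
  · refine Or.inr (Or.inr ⟨rfl, fun w => ?_⟩)
    rcases h (Sum.inr w) with h | ⟨z | z, hz, h⟩
    · exact Or.inl h
    · exact absurd hz (by simp)
    · exact Or.inr ⟨z, hz, by simpa using h⟩
  · exact Or.inl ⟨hX, hY⟩

theorem sumSet_insert_left {a : V} : sumSet (insert a X, Y) = insert (Sum.inl a) (sumSet (X, Y)) := by
  ext (z | z) <;> simp

theorem joinRel_left (h : Dom G H (X, Y)) (h' : Dom G H (X', Y)) (hX : TARAdj X X' ∨ TSAdj G X X') :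
    JoinRel G H (X, Y) (X', Y) := by
  refine ⟨h, h', hX.imp ?_ ?_⟩
  · rintro (⟨w, hw, rfl⟩ | ⟨w, hw, rfl⟩)
    · exact Or.inl ⟨Sum.inl w, hw, sumSet_insert_left⟩
    · refine Or.inr ⟨Sum.inl w, hw, ?_⟩
      ext (z | z) <;> simp
  · rintro ⟨a, ha, b, ⟨hb, hb'⟩, hab, rfl⟩
    refine ⟨Sum.inl a, ha, Sum.inl b, ⟨hb, hb'⟩, by simpa, ?_⟩
    ext (z | z) <;> simp

theorem joinRel_right (h : Dom G H (X, Y)) (h' : Dom G H (X, Y'))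
    (hY : TARAdj Y Y' ∨ TSAdj H Y Y') : JoinRel G H (X, Y) (X, Y') :=
  (joinRel_left h.swap h'.swap hY).swap

theorem joinRel_slide {a : V} {b : W} (ha : a ∉ X) (hb : b ∉ Y) (h : Dom G H (insert a X, Y))
    (h' : Dom G H (X, insert b Y)) : JoinRel G H (insert a X, Y) (X, insert b Y) := by
  refine ⟨h, h', Or.inr ⟨Sum.inl a, by simp, Sum.inr b, ⟨by simp, by simpa⟩, by simp, ?_⟩⟩
  ext (z | z)
  · simp only [inl_mem_sumSet, mem_sdiff, mem_union, mem_insert_iff, mem_singleton_iff,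
      Sum.inl.injEq, reduceCtorEq, or_false]
    refine ⟨fun hz => ⟨Or.inr hz, fun h => ha (h ▸ hz)⟩, ?_⟩
    rintro ⟨h | h, h'⟩
    exacts [absurd h h', h]
  · simp

theorem ncard_nonempty [Finite V] : {X : Set V | X.Nonempty}.ncard = 2 ^ Nat.card V - 1 := by
  have := Fintype.ofFinite V
  have e : {X : Set V | X.Nonempty} = {∅}ᶜ := by
    ext X; simp [Set.nonempty_iff_ne_empty]
  rw [e, Set.ncard_compl, Set.ncard_singleton, Nat.card_eq_fintype_card, Fintype.card_set,
    Nat.card_eq_fintype_card]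

theorem card_dominating_le [Finite V] [Nonempty V] :
    Nat.card {X // G.IsDominatingSet X} ≤ 2 ^ Nat.card V - 1 := by
  rw [← ncard_nonempty]
  exact Set.ncard_le_ncard (s := {X | G.IsDominatingSet X})
    (fun X hX => nonempty_of_isDominatingSet hX) (toFinite _)

theorem card_dominating_pos [Finite V] : 1 ≤ Nat.card {X // G.IsDominatingSet X} := by
  have : Nonempty {X // G.IsDominatingSet X} := ⟨⟨univ, isDominatingSet_univ⟩⟩
  exact Nat.card_pos

/-- An upper bound suffices: it only has to cap the cycle lengths that must be realised. -/
theorem card_dominating_join_le [Finite V] [Finite W] :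
    Nat.card {Z // (G.join H).IsDominatingSet Z} ≤ (2 ^ Nat.card V - 1) * (2 ^ Nat.card W - 1) +
      Nat.card {X // G.IsDominatingSet X} + Nat.card {Y // H.IsDominatingSet Y} := by
  have hsub : {Z | (G.join H).IsDominatingSet Z} ⊆ sumSet '' (({X : Set V | X.Nonempty} ×ˢ
      {Y : Set W | Y.Nonempty}) ∪ ({X | G.IsDominatingSet X} ×ˢ {∅}) ∪
      ({∅} ×ˢ {Y | H.IsDominatingSet Y})) := by
    intro Z hZ
    obtain ⟨x, rfl⟩ := sumSet_surjective Z
    refine ⟨x, ?_, rfl⟩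
    rcases Dom.cases hZ with h | h | h
    exacts [Or.inl (Or.inl h), Or.inl (Or.inr h), Or.inr h]
  refine (Set.ncard_le_ncard hsub (toFinite _)).trans ((Set.ncard_image_le (toFinite _)).trans ?_)
  refine (Set.ncard_union_le _ _).trans (add_le_add ((Set.ncard_union_le _ _).trans ?_) ?_)
  · rw [Set.ncard_prod, Set.ncard_prod, ncard_nonempty, ncard_nonempty, Set.ncard_singleton,
      mul_one]
    exact le_rfl
  · rw [Set.ncard_prod, Set.ncard_singleton, one_mul]
    exact le_rfl

theorem isPancyclic_join_of_hasCycle [Finite V] [Finite W] (h : ∀ k, 3 ≤ k →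
    k ≤ (2 ^ Nat.card V - 1) * (2 ^ Nat.card W - 1) + Nat.card {X // G.IsDominatingSet X} +
      Nat.card {Y // H.IsDominatingSet Y} → HasCycle (JoinRel G H) k) :
    (G.join H).tarsGraph.IsPancyclic :=
  isPancyclic_tarsGraph_iff.2 fun k hk hk' =>
    (h k hk (hk'.trans card_dominating_join_le)).map sumSet_injective fun _ _ h => h

theorem isChain_map_left [Nonempty V] {l : List (Set V)} (hl : l.IsChain (TarsRel G)) :
    (l.map fun X => (X, (∅ : Set W))).IsChain (JoinRel G H) :=
  List.isChain_map_of_isChain _ (fun _ _ h => joinRel_left (dom_left h.1) (dom_left h.2.1) h.2.2) hl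

/-- A Hamiltonian path of the TARS-graph of `G` as a detour in the TARS-graph of the join. -/
theorem pathThrough_left [Nonempty V] {l : List (Set V)} {v : V} {w : W} {z : Set V × Set W}
    (hnd : (univ :: l).Nodup) (hc : (univ :: l).IsChain (TarsRel G))
    (hdom : ∀ X ∈ univ :: l, G.IsDominatingSet X)
    (hl : l = [] ∨ l.getLast? = some (univ \ {v})) (hz : JoinRel G H z (univ, ∅))
    (hd : Dom G H (univ \ {v}, {w})) :
    PathThrough (JoinRel G H) {x | x.1.Nonempty ∧ x.2 = ∅} z (univ \ {v}, {w}) (l.length + 1) := by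
  have hdw : Dom G H (univ, {w}) := dom_of_nonempty univ_nonempty (singleton_nonempty w)
  have := PathThrough.of_list (l := (univ :: l).map fun X => (X, (∅ : Set W)))
    (r := JoinRel G H) (S := {x | x.1.Nonempty ∧ x.2 = ∅}) (a := z) (b := (univ \ {v}, {w}))
    (by simp) (hnd.map (Prod.mk_left_injective _)) ?_ (isChain_map_left hc) ?_ ?_
  · simpa using this
  · intro x hx
    obtain ⟨X, hX, rfl⟩ := List.mem_map.1 hx
    exact ⟨nonempty_of_isDominatingSet (hdom X hX), rfl⟩
  · simpa using hz
  · intro x hx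
    -- If `univ` is the only dominating set, the detour leaves by sliding from `v` to `w`; otherwise
    -- it ends at `univ \ {v}` and leaves by adding `w`.
    rcases hl with rfl | hl
    · obtain rfl : x = (univ, ∅) := by simpa using hx.symm
      have := joinRel_slide (G := G) (H := H) (X := univ \ {v}) (Y := ∅) (a := v) (b := w)
        (by simp) (by simp) (by simpa using dom_left isDominatingSet_univ) (by simpa using hd)
      simpa using this
    · obtain rfl : x = (univ \ {v}, ∅) := by
        rw [List.map_cons, List.getLast?_cons, List.getLast?_map, hl] at hx
        simpa using hx.symm
      have hdv : Dom G H (univ \ {v}, ∅) :=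
        dom_left (hdom _ (List.mem_cons_of_mem _ (List.mem_of_getLast? hl)))
      refine joinRel_right hdv hd (Or.inl ?_)
      simpa using tarAdj_insert_right (X := (∅ : Set W)) (w := w) (by simp)

/-- In the TARS-graph of the join, there is a detour through all dominating sets of `G`. -/
theorem exists_pathThrough_left [Finite V] [Nonempty V] (h : G.tarsGraph.IsPancyclic) :
    ∃ v : V, ∀ (w : W) (z : Set V × Set W), JoinRel G H z (univ, ∅) →
      Dom G H (univ \ {v}, {w}) →
      PathThrough (JoinRel G H) {x | x.1.Nonempty ∧ x.2 = ∅} z (univ \ {v}, {w})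
        (Nat.card {X // G.IsDominatingSet X}) := by
  obtain ⟨l, hnd, hc, hdom, hlen, hl⟩ := exists_dominating_path h
  obtain ⟨v, hv⟩ : ∃ v, l = [] ∨ l.getLast? = some (univ \ {v}) := by
    rcases hl with h | ⟨v, h⟩
    · exact ⟨Classical.arbitrary V, Or.inl h⟩
    · exact ⟨v, Or.inr h⟩
  rw [← hlen]
  exact ⟨v, fun w z hz hd => pathThrough_left hnd hc hdom hv hz hd⟩

theorem exists_pathThrough_right [Finite W] [Nonempty W] (h : H.tarsGraph.IsPancyclic) :
    ∃ w : W, ∀ (v : V) (z : Set V × Set W), JoinRel G H z (∅, univ) →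
      Dom G H ({v}, univ \ {w}) →
      PathThrough (JoinRel G H) {x | x.1 = ∅ ∧ x.2.Nonempty} z ({v}, univ \ {w})
        (Nat.card {Y // H.IsDominatingSet Y}) := by
  obtain ⟨w, hw⟩ := exists_pathThrough_left (H := G) h
  refine ⟨w, fun v z hz hd => ?_⟩
  have := (hw v z.swap hz.swap hd.swap).map Prod.swap_injective (fun x y h => JoinRel.swap h)
  refine PathThrough.mono (by simpa using this) ?_
  rintro _ ⟨⟨X, Y⟩, h, rfl⟩
  exact ⟨h.2, h.1⟩

theorem joinRel_univ_empty [Nonempty V] {w : W} : JoinRel G H (univ, {w}) (univ, ∅) := by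
  refine (joinRel_right (dom_left isDominatingSet_univ)
    (dom_of_nonempty univ_nonempty (singleton_nonempty w)) (Or.inl ?_)).symm
  simpa using tarAdj_insert_right (X := (∅ : Set W)) (w := w) (by simp)

theorem joinRel_empty_univ [Nonempty W] {v : V} : JoinRel G H ({v}, univ) (∅, univ) :=
  (joinRel_univ_empty (G := H) (H := G)).swap

end TarsCycles

/-! ### The join as a grid: at least two vertices on both sides -/

namespace TarsCycles

open Set SimpleGraph

variable {V : Type u} {W : Type v} {G : SimpleGraph V} {H : SimpleGraph W}
  {v : V} {w : W} {γ : Set V → ℕ} {η : Set W → ℕ}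

theorem IsGrayIndex.nonempty_iff (h : IsGrayIndex v γ) {X : Set V} : X.Nonempty ↔ 0 < γ X := by
  rw [Set.nonempty_iff_ne_empty, Nat.pos_iff_ne_zero, ← h.map_empty, h.injective.ne_iff]

theorem sdiff_singleton_nonempty (hV : 2 ≤ Nat.card V) (v : V) :
    ((univ : Set V) \ {v}).Nonempty := by
  have := Nat.finite_of_card_ne_zero (α := V) (by omega)
  obtain ⟨a, b, hab⟩ := Finite.one_lt_card_iff_nontrivial.1 (show 1 < Nat.card V by omega)
  by_cases h : a = v
  · exact ⟨b, mem_univ _, fun h' => hab (h.trans h'.symm)⟩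
  · exact ⟨a, mem_univ _, h⟩

/-- Adjacency in the TARS-graph of the join, in terms of the positions in two Gray codes. -/
def IndexRel (G : SimpleGraph V) (H : SimpleGraph W) (γ : Set V → ℕ) (η : Set W → ℕ) :
    ℕ × ℕ → ℕ × ℕ → Prop :=
  Relation.Map (JoinRel G H) (Prod.map γ η) (Prod.map γ η)

theorem IndexRel.symm {x y : ℕ × ℕ} (h : IndexRel G H γ η x y) : IndexRel G H γ η y x := by
  obtain ⟨a, b, h, rfl, rfl⟩ := h
  exact ⟨b, a, h.symm, rfl, rfl⟩

theorem JoinRel.indexRel {X X' : Set V} {Y Y' : Set W} (h : JoinRel G H (X, Y) (X', Y')) :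
    IndexRel G H γ η (γ X, η Y) (γ X', η Y') := ⟨_, _, h, rfl, rfl⟩

/-- Consecutive sets in the codes differ by one element, `a` or `b`. Of the four corners of a
square, the two containing exactly one of `a` and `b` differ by a slide along the join edge `a b`.
Starting at position `1` keeps both sets nonempty. -/
theorem triangulatedGrid_indexRel (hγ : IsGrayIndex v γ) (hη : IsGrayIndex w η) :
    TriangulatedGrid (IndexRel G H γ η) (2 ^ Nat.card V - 1) (2 ^ Nat.card W - 1) where
  symm _ _ := IndexRel.symm
  vert i j hi hip hj hjq := by
    obtain ⟨X, rfl⟩ := hγ.surj i (by omega)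
    obtain ⟨X', hX'⟩ := hγ.surj (γ X + 1) (by omega)
    obtain ⟨Y, rfl⟩ := hη.surj j (by omega)
    rw [← hX']
    have hY := hη.nonempty_iff.2 hj
    exact (joinRel_left (dom_of_nonempty (hγ.nonempty_iff.2 hi) hY)
      (dom_of_nonempty (hγ.nonempty_iff.2 (by omega)) hY) (Or.inl (hγ.tarAdj _ _ hX'))).indexRel
  horiz i j hi hip hj hjq := by
    obtain ⟨X, rfl⟩ := hγ.surj i (by omega)
    obtain ⟨Y, rfl⟩ := hη.surj j (by omega)
    obtain ⟨Y', hY'⟩ := hη.surj (η Y + 1) (by omega)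
    rw [← hY']
    have hX := hγ.nonempty_iff.2 hi
    exact (joinRel_right (dom_of_nonempty hX (hη.nonempty_iff.2 hj))
      (dom_of_nonempty hX (hη.nonempty_iff.2 (by omega))) (Or.inl (hη.tarAdj _ _ hY'))).indexRel
  diag i j hi hip hj hjq := by
    obtain ⟨X, rfl⟩ := hγ.surj i (by omega)
    obtain ⟨X', hX'⟩ := hγ.surj (γ X + 1) (by omega)
    obtain ⟨Y, rfl⟩ := hη.surj j (by omega)
    obtain ⟨Y', hY'⟩ := hη.surj (η Y + 1) (by omega)
    rw [← hX', ← hY']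
    have hX : X.Nonempty := hγ.nonempty_iff.2 hi
    have hXn : X'.Nonempty := hγ.nonempty_iff.2 (by omega)
    have hY : Y.Nonempty := hη.nonempty_iff.2 hj
    have hYn : Y'.Nonempty := hη.nonempty_iff.2 (by omega)
    rcases tarAdj_exists_insert (hγ.tarAdj _ _ hX') with ⟨a, ha, rfl⟩ | ⟨a, ha, rfl⟩ <;>
      rcases tarAdj_exists_insert (hη.tarAdj _ _ hY') with ⟨b, hb, rfl⟩ | ⟨b, hb, rfl⟩
    · exact Or.inr (joinRel_slide ha hb (dom_of_nonempty hXn hY)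
        (dom_of_nonempty hX hYn)).symm.indexRel
    · exact Or.inl (joinRel_slide ha hb (dom_of_nonempty hXn hYn)
        (dom_of_nonempty hX hY)).symm.indexRel
    · exact Or.inl (joinRel_slide ha hb (dom_of_nonempty hX hY)
        (dom_of_nonempty hXn hYn)).indexRel
    · exact Or.inr (joinRel_slide ha hb (dom_of_nonempty hX hYn)
        (dom_of_nonempty hXn hY)).indexRel

theorem hasCycle_of_indexRel (hγ : IsGrayIndex v γ) (hη : IsGrayIndex w η) {k : ℕ}
    (h : HasCycle (IndexRel G H γ η) k) : HasCycle (JoinRel G H) k :=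
  h.of_map (hγ.injective.prodMap hη.injective)

theorem pathThrough_indexRel_left (hγ : IsGrayIndex v γ) (hη : IsGrayIndex w η) {k : ℕ}
    {X X' : Set V} {Y Y' : Set W}
    (h : PathThrough (JoinRel G H) {x | x.1.Nonempty ∧ x.2 = ∅} (X, Y) (X', Y') k) :
    PathThrough (IndexRel G H γ η) {x | 0 < x.1 ∧ x.2 = 0} (γ X, η Y) (γ X', η Y') k := by
  refine (h.map (hγ.injective.prodMap hη.injective) fun x y h => ⟨x, y, h, rfl, rfl⟩).mono ?_
  rintro _ ⟨⟨X, Y⟩, ⟨h1, h2⟩, rfl⟩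
  exact ⟨hγ.nonempty_iff.1 h1, by rw [← hη.map_empty]; exact congrArg η h2⟩

theorem pathThrough_indexRel_right (hγ : IsGrayIndex v γ) (hη : IsGrayIndex w η) {k : ℕ}
    {X X' : Set V} {Y Y' : Set W}
    (h : PathThrough (JoinRel G H) {x | x.1 = ∅ ∧ x.2.Nonempty} (X, Y) (X', Y') k) :
    PathThrough (IndexRel G H γ η) {x | x.1 = 0 ∧ 0 < x.2} (γ X, η Y) (γ X', η Y') k := by
  refine (h.map (hγ.injective.prodMap hη.injective) fun x y h => ⟨x, y, h, rfl, rfl⟩).mono ?_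
  rintro _ ⟨⟨X, Y⟩, ⟨h1, h2⟩, rfl⟩
  exact ⟨by rw [← hγ.map_empty]; exact congrArg γ h1, hη.nonempty_iff.1 h2⟩

/-- The two positions next to each other that are occupied by the whole set and the complement
of `v`. -/
theorem IsGrayIndex.exists_edge (h : IsGrayIndex v γ) (hV : 2 ≤ Nat.card V) :
    ∃ s, 2 ≤ s ∧ s < 2 ^ Nat.card V - 1 ∧
      (s = γ univ ∧ s + 1 = γ (univ \ {v}) ∨ s = γ (univ \ {v}) ∧ s + 1 = γ univ) := by
  obtain ⟨a, ha⟩ := sdiff_singleton_nonempty hV v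
  have h1 : 0 < γ (univ \ {v}) := h.nonempty_iff.1 ⟨a, ha⟩
  have h2 : 0 < γ univ := h.nonempty_iff.1 ⟨a, mem_univ a⟩
  have h3 : γ (univ \ {v}) ≠ 1 := by
    rw [← h.map_singleton, h.injective.ne_iff]
    intro h
    have : v ∈ (univ : Set V) \ {v} := by rw [h]; exact mem_singleton v
    exact this.2 rfl
  have h4 : γ univ ≠ 1 := by
    rw [← h.map_singleton, h.injective.ne_iff]
    intro h
    exact ha.2 (h ▸ mem_univ a)
  have h5 := h.lt univ
  have h6 := h.lt (univ \ {v})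
  rcases h.univ_adj with h7 | h7
  · exact ⟨γ (univ \ {v}), by omega, by omega, Or.inr ⟨rfl, h7.symm⟩⟩
  · exact ⟨γ univ, by omega, by omega, Or.inl ⟨rfl, h7.symm⟩⟩

theorem odd_two_pow_sub_one {n : ℕ} (hn : 2 ≤ n) : Odd (2 ^ n - 1) :=
  Nat.Even.sub_odd Nat.one_le_two_pow ((even_two.pow_of_ne_zero (by omega))) odd_one

theorem isPancyclic_join_of_three_le [Finite V] [Finite W] (hG : G.tarsGraph.IsPancyclic)
    (hH : H.tarsGraph.IsPancyclic) (hV : 3 ≤ Nat.card V) (hW : 2 ≤ Nat.card W)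
    (hWV : Nat.card W ≤ Nat.card V) : (G.join H).tarsGraph.IsPancyclic := by
  have : Nonempty V := (Nat.card_pos_iff.1 (by omega)).1
  have : Nonempty W := (Nat.card_pos_iff.1 (by omega)).1
  obtain ⟨v, hv⟩ := exists_pathThrough_left (H := H) hG
  obtain ⟨w, hw⟩ := exists_pathThrough_right (G := G) hH
  obtain ⟨γ, hγ⟩ := exists_isGrayIndex v
  obtain ⟨η, hη⟩ := exists_isGrayIndex w
  have hg := triangulatedGrid_indexRel (G := G) (H := H) hγ hη
  have hp8 : 2 ^ 3 ≤ 2 ^ Nat.card V := Nat.pow_le_pow_right (by omega) hV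
  have hq4 : 2 ^ 2 ≤ 2 ^ Nat.card W := Nat.pow_le_pow_right (by omega) hW
  have hqp : 2 ^ Nat.card W ≤ 2 ^ Nat.card V := Nat.pow_le_pow_right (by omega) hWV
  obtain ⟨s, hs, hs', hsV⟩ := hγ.exists_edge (by omega)
  obtain ⟨t, ht, ht', htW⟩ := hη.exists_edge hW
  have hA := pathThrough_indexRel_left hγ hη (hv w (univ, {w}) joinRel_univ_empty
    (dom_of_nonempty (sdiff_singleton_nonempty (by omega) v) (singleton_nonempty w)))
  have hB := pathThrough_indexRel_right hγ hη (hw v ({v}, univ) joinRel_empty_univ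
    (dom_of_nonempty (singleton_nonempty v) (sdiff_singleton_nonempty (by omega) w)))
  rw [hη.map_singleton] at hA
  rw [hγ.map_singleton] at hB
  -- The first code inserts `a` here, while the second ends with a deletion: its last set is a
  -- singleton whose predecessor is nonempty. Hence the slide joins exactly these two corners.
  have hcorner : IndexRel G H γ η (4, 2 ^ Nat.card W - 1 - 1) (5, 2 ^ Nat.card W - 1) := by
    obtain ⟨X, hX⟩ := hγ.surj 4 (by omega)
    obtain ⟨X', hX'⟩ := hγ.surj 5 (by omega)
    obtain ⟨Y, hY⟩ := hη.surj (2 ^ Nat.card W - 1 - 1) (by omega)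
    obtain ⟨y, hy⟩ := hη.map_last
    obtain ⟨a, ha, rfl⟩ := hγ.exists_insert hV X X' hX hX'
    have hYn : Y.Nonempty := hη.nonempty_iff.2 (by omega)
    have hXn : X.Nonempty := hγ.nonempty_iff.2 (by omega)
    rw [← hX, ← hX', ← hY, ← hy]
    rcases tarAdj_exists_insert (hη.tarAdj Y {y} (by omega)) with ⟨b, hb, hbY⟩ | ⟨b, hb, rfl⟩
    · obtain ⟨c, hc⟩ := hYn
      have h1 : c = y := (hbY ▸ mem_insert_of_mem b hc : c ∈ ({y} : Set W))
      have h2 : b = y := (hbY ▸ mem_insert b Y : b ∈ ({y} : Set W))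
      exact absurd (h2.trans h1.symm ▸ hc) hb
    · exact (joinRel_slide ha hb (dom_of_nonempty (insert_nonempty _ _) (singleton_nonempty y))
        (dom_of_nonempty hXn hYn)).symm.indexRel
  refine isPancyclic_join_of_hasCycle fun k hk hk' => hasCycle_of_indexRel hγ hη ?_
  refine hg.hasCycle (odd_two_pow_sub_one (by omega)) (by omega) (odd_two_pow_sub_one hW)
    (by omega) (by omega) hcorner (s := s) (t := t) (by omega) hs' ht ht' ?_ ?_ card_dominating_le
    card_dominating_pos card_dominating_le hk hk'
  · rcases hsV with ⟨h1, h2⟩ | ⟨h1, h2⟩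
    · rw [h1] at h2 ⊢; rw [h2]; exact hA
    · rw [h1] at h2 ⊢; rw [h2]; exact hA.symm hg.symm
  · rcases htW with ⟨h1, h2⟩ | ⟨h1, h2⟩
    · rw [h1] at h2 ⊢; rw [h2]; exact hB
    · rw [h1] at h2 ⊢; rw [h2]; exact hB.symm hg.symm

/-- The code must be `∅, {v}, univ, univ \ {v}`, because it ends with a singleton. -/
theorem IsGrayIndex.of_card_eq_two (h : IsGrayIndex v γ) (hV : Nat.card V = 2) :
    γ univ = 2 ∧ γ (univ \ {v}) = 3 ∧ ∃ a, a ∉ ({v} : Set V) ∧ univ = insert a {v} := by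
  obtain ⟨s, h1, h2, h3⟩ := h.exists_edge hV.ge
  obtain ⟨x, hx⟩ := h.map_last
  rw [hV] at h2 hx
  have hne : γ univ ≠ 3 := by
    intro h4
    obtain ⟨a, -, ha⟩ := sdiff_singleton_nonempty hV.ge x
    have := h.injective (h4.trans hx.symm)
    exact ha (this ▸ mem_univ a)
  have h2' : γ univ = 2 ∧ γ (univ \ {v}) = 3 := by omega
  refine ⟨h2'.1, h2'.2, ?_⟩
  rcases tarAdj_exists_insert (h.tarAdj {v} univ (by rw [h2'.1, h.map_singleton])) with h | ⟨a, ha, -⟩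
  · exact h
  · exact absurd (mem_univ a) ha

theorem joinRel_of_eq_insert {X X' : Set V} {Y Y' : Set W} {a : V} {b : W} (ha : a ∉ X)
    (hX : X' = insert a X) (hb : b ∉ Y) (hY : Y' = insert b Y) (h : Dom G H (X', Y))
    (h' : Dom G H (X, Y')) : JoinRel G H (X', Y) (X, Y') := by
  subst hX hY
  exact joinRel_slide ha hb h h'

theorem isPancyclic_join_of_card_eq_two [Finite V] [Finite W] (hG : G.tarsGraph.IsPancyclic)
    (hH : H.tarsGraph.IsPancyclic) (hV : Nat.card V = 2) (hW : Nat.card W = 2) :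
    (G.join H).tarsGraph.IsPancyclic := by
  have : Nonempty V := (Nat.card_pos_iff.1 (by omega)).1
  have : Nonempty W := (Nat.card_pos_iff.1 (by omega)).1
  obtain ⟨v, hv⟩ := exists_pathThrough_left (H := H) hG
  obtain ⟨w, hw⟩ := exists_pathThrough_right (G := G) hH
  obtain ⟨γ, hγ⟩ := exists_isGrayIndex v
  obtain ⟨η, hη⟩ := exists_isGrayIndex w
  have hg := triangulatedGrid_indexRel (G := G) (H := H) hγ hη
  obtain ⟨hγ2, hγ3, a, ha, hau⟩ := hγ.of_card_eq_two hV
  obtain ⟨hη2, hη3, b, hb, hbu⟩ := hη.of_card_eq_two hW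
  have hvn := sdiff_singleton_nonempty hV.ge v
  have hwn := sdiff_singleton_nonempty hW.ge w
  have hvu : univ = insert v (univ \ {v}) := by simp
  have hwu : univ = insert w (univ \ {w}) := by simp
  have hA := pathThrough_indexRel_left hγ hη (hv w (univ, {w}) joinRel_univ_empty
    (dom_of_nonempty hvn (singleton_nonempty w)))
  have hBd : Dom G H ({v}, univ \ {w}) := dom_of_nonempty (singleton_nonempty v) hwn
  have hB := pathThrough_indexRel_right hγ hη (hw v ({v}, univ) joinRel_empty_univ hBd)
  -- As `|W| = 2`, the pair `({v}, {w})` also reaches `(∅, univ)`, by sliding from `v` to the other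
  -- vertex of `W`.
  have hB' := pathThrough_indexRel_right hγ hη (hw v ({v}, {w})
    (joinRel_of_eq_insert (notMem_empty v) (by simp) hb hbu
      (dom_of_nonempty (singleton_nonempty v) (singleton_nonempty w))
      (dom_right isDominatingSet_univ)) hBd)
  have h₁ := (joinRel_of_eq_insert (G := G) (H := H) ha hau hb hbu
    (dom_of_nonempty univ_nonempty (singleton_nonempty w))
    (dom_of_nonempty (singleton_nonempty v) univ_nonempty)).indexRel (γ := γ) (η := η)
  have h₂ := (joinRel_of_eq_insert (G := G) (H := H) ha hau (by simp) hwu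
    (dom_of_nonempty univ_nonempty hwn)
    (dom_of_nonempty (singleton_nonempty v) univ_nonempty)).symm.indexRel (γ := γ) (η := η)
  have h₃ := (joinRel_of_eq_insert (G := G) (H := H) (by simp) hvu (by simp) hwu
    (dom_of_nonempty univ_nonempty hwn)
    (dom_of_nonempty hvn univ_nonempty)).indexRel (γ := γ) (η := η)
  have h₄ := (joinRel_of_eq_insert (G := G) (H := H) (by simp) hvu hb hbu
    (dom_of_nonempty univ_nonempty (singleton_nonempty w))
    (dom_of_nonempty hvn univ_nonempty)).symm.indexRel (γ := γ) (η := η)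
  have hcG := card_dominating_le (G := G)
  have hcH := card_dominating_le (G := H)
  rw [hV] at hg hcG
  rw [hW] at hg hcH
  simp only [hγ2, hγ3, hη2, hη3, hγ.map_singleton, hη.map_singleton] at hA hB hB' h₁ h₂ h₃ h₄
  refine isPancyclic_join_of_hasCycle fun k hk hk' => hasCycle_of_indexRel hγ hη ?_
  rw [hV, hW] at hk'
  exact hg.hasCycle_three h₁ h₂ h₃ h₄ hA hB hB' hcG hcH hk hk'

end TarsCycles

/-! ### Joining with a single vertex -/

namespace TarsCycles

open Set SimpleGraph
open scoped symmDiff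

variable {V : Type u} {W : Type v} {G : SimpleGraph V} {H : SimpleGraph W}

theorem tarAdj_iff {X Y : Set V} : TARAdj X Y ↔ ∃ w, ∀ z, z ∈ Y ↔ (z ∈ X ↔ z ≠ w) := by
  constructor
  · rintro (⟨w, hw, rfl⟩ | ⟨w, hw, rfl⟩)
    · refine ⟨w, fun z => ?_⟩
      by_cases hz : z = w
      · subst hz; simp [hw]
      · simp [hz]
    · refine ⟨w, fun z => ?_⟩
      by_cases hz : z = w
      · subst hz; simp [hw]
      · simp [hz]
  · rintro ⟨w, hw⟩
    by_cases h : w ∈ X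
    · refine Or.inr ⟨w, h, Set.ext fun z => ?_⟩
      rw [hw z]
      by_cases hz : z = w
      · subst hz; simp [h]
      · simp [hz]
    · refine Or.inl ⟨w, h, Set.ext fun z => ?_⟩
      rw [hw z]
      by_cases hz : z = w
      · subst hz; simp [h]
      · simp [hz]

theorem tarAdj_symmDiff {X Y : Set V} (Z : Set V) (h : TARAdj X Y) : TARAdj (Z ∆ X) (Z ∆ Y) := by
  rw [tarAdj_iff] at h ⊢
  obtain ⟨w, hw⟩ := h
  refine ⟨w, fun z => ?_⟩
  have := hw z
  simp only [mem_symmDiff]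
  by_cases h1 : z = w <;> by_cases h2 : z ∈ X <;> by_cases h3 : z ∈ Z <;> simp_all

theorem length_gray (l : List V) : (gray l).length = 2 ^ l.length := by
  induction l with
  | nil => rfl
  | cons x l ih => simp [gray, ih, pow_succ]; ring

/-- Cycles through the rungs of a ladder: each `X` in a list is joined to `insert v X`. -/
theorem pathThrough_ladder {v : V} {X : Set V} {l : List (Set V)} (hnd : (X :: l).Nodup)
    (hc : (X :: l).IsChain TARAdj) (hv : ∀ Y ∈ X :: l, v ∉ Y) (j : ℕ) (hj : j ≤ l.length) :
    PathThrough TARAdj {Z | Z \ {v} ∈ l} X (insert v X) (2 * j) := by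
  induction l generalizing X j with
  | nil =>
    obtain rfl : j = 0 := by simpa using hj
    exact .of_rel (tarAdj_insert_right (hv X (by simp)))
  | cons Y l ih =>
    cases j with
    | zero => exact .of_rel (tarAdj_insert_right (hv X (by simp)))
    | succ j =>
      have hvX := hv X (by simp)
      have hvY := hv Y (by simp)
      rw [List.isChain_cons_cons] at hc
      rw [List.nodup_cons] at hnd
      have hYl : Y ∉ l := (List.nodup_cons.1 hnd.2).1
      have h1 := ih hnd.2 hc.2 (fun Z hZ => hv Z (List.mem_cons_of_mem _ hZ)) j
        (by simpa using hj)
      have eY : Y \ {v} = Y := by simp [hvY]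
      have eY' : insert v Y \ {v} = Y := by simp [hvY]
      have h2 := h1.trans (S := {Z | Z \ {v} ∈ l} ∪ {insert v Y})
        (.of_rel (S := ∅) (SimpleGraph.TARAdj.symm (tarAdj_insert_insert hvX hvY hc.1))) (by
          refine fun Z => ⟨fun hZ => ⟨Or.inl hZ, by simp, ?_⟩, fun hZ => absurd hZ (by simp)⟩
          rintro rfl
          have : insert v Y \ {v} ∈ l := hZ
          exact hYl (eY' ▸ this)) (by simp)
      have h3 := (PathThrough.of_rel (S := ∅) hc.1).trans (S := {Z | Z \ {v} ∈ Y :: l}) h2 (by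
          refine fun Z => ⟨fun hZ => absurd hZ (by simp), ?_⟩
          rintro (hZ | rfl)
          · refine ⟨List.mem_cons_of_mem _ hZ, ?_⟩
            rintro rfl
            have : Z \ {v} ∈ l := hZ
            exact hYl (eY ▸ this)
          · refine ⟨?_, fun h => hvY (h ▸ mem_insert v Y)⟩
            show insert v Y \ {v} ∈ Y :: l
            rw [eY']; exact List.mem_cons_self) (by
          show Y \ {v} ∈ Y :: l
          rw [eY]; exact List.mem_cons_self)
      convert h3 using 1
      omega

/-- Every edge of the cube lies on cycles of all even lengths. -/
theorem pathThrough_cube [Finite V] {v : V} {X : Set V} (hv : v ∉ X) (j : ℕ)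
    (hj : j + 1 ≤ 2 ^ (Nat.card V - 1)) :
    PathThrough TARAdj {Z | Z ≠ X ∧ Z ≠ insert v X} X (insert v X) (2 * j) := by
  classical
  have := Fintype.ofFinite V
  set l := (Finset.univ.erase v).toList with hl
  have hln : l.Nodup := Finset.nodup_toList _
  have hll : l.length = Nat.card V - 1 := by
    rw [hl, Finset.length_toList, Finset.card_erase_of_mem (Finset.mem_univ v), Finset.card_univ,
      Nat.card_eq_fintype_card]
  obtain ⟨t, ht⟩ := gray_eq_cons l
  -- Symmetric difference with `X` is an automorphism of the cube; it moves the start of the code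
  -- from `∅` to `X`.
  have hnd := (nodup_gray hln).map (symmDiff_right_injective X)
  have hc := List.isChain_map_of_isChain (X ∆ ·) (fun _ _ h => tarAdj_symmDiff X h)
    (isChain_gray hln)
  have hmem : ∀ Y ∈ (gray l).map (X ∆ ·), v ∉ Y := by
    intro Y hY
    obtain ⟨Z, hZ, rfl⟩ := List.mem_map.1 hY
    have hvZ : v ∉ Z := fun h => by
      have := mem_gray.1 hZ h
      simp [hl] at this
    simp [mem_symmDiff, hv, hvZ]
  have hlen := length_gray l
  rw [ht] at hnd hc hmem hlen
  have e : List.map (X ∆ ·) (∅ :: t) = X :: t.map (X ∆ ·) := by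
    rw [List.map_cons]
    congr 1
    exact symmDiff_bot X
  rw [e] at hnd hc hmem
  refine (pathThrough_ladder hnd hc hmem j ?_).mono ?_
  · rw [List.length_map]
    rw [List.length_cons, hll] at hlen
    omega
  · have hX : X ∉ t.map (X ∆ ·) := (List.nodup_cons.1 hnd).1
    intro Z hZ
    have hZ : Z \ {v} ∈ t.map (X ∆ ·) := hZ
    refine ⟨?_, ?_⟩
    · rintro rfl
      exact hX (by simpa [hv] using hZ)
    · rintro rfl
      exact hX (by simpa [hv] using hZ)

/-- Every `(X, {w})` is dominating, so these pairs contain a full cube. Its edges lie on cycles of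
all even lengths, and replacing an edge by a detour through column `∅` supplies the rest, including
the odd lengths. -/
theorem isPancyclic_join_of_card_eq_one [Finite V] [Finite W] [Nonempty V]
    (hG : G.tarsGraph.IsPancyclic) (hW : Nat.card W = 1) : (G.join H).tarsGraph.IsPancyclic := by
  obtain ⟨hsub, ⟨w⟩⟩ := Nat.card_eq_one_iff_unique.1 hW
  have : Nonempty W := ⟨w⟩
  have hdom : ∀ X : Set V, Dom G H (X, {w}) := by
    intro X
    rcases X.eq_empty_or_nonempty with rfl | hX
    · exact dom_right fun y => Or.inl (Subsingleton.elim y w)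
    · exact dom_of_nonempty hX (singleton_nonempty w)
  obtain ⟨l, hnd, hc, hld, hlen, hl⟩ := exists_dominating_path hG
  obtain ⟨v, hv⟩ : ∃ v, l = [] ∨ l.getLast? = some (univ \ {v}) := by
    rcases hl with h | ⟨v, h⟩
    · exact ⟨Classical.arbitrary V, Or.inl h⟩
    · exact ⟨v, Or.inr h⟩
  have hpow : 2 ^ Nat.card V = 2 * 2 ^ (Nat.card V - 1) := by
    rw [← pow_succ']
    congr 1
    have : 0 < Nat.card V := Nat.card_pos
    omega
  have cube : ∀ {u : V} {X X' : Set V} {k m : ℕ}, u ∉ X → X' = insert u X →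
      PathThrough (JoinRel G H) {x | x.1.Nonempty ∧ x.2 = ∅} (X', {w}) (X, {w}) k →
      2 ∣ m → 2 ≤ m → m ≤ 2 ^ Nat.card V → HasCycle (JoinRel G H) (m + k) := by
    rintro u X _ k m hu rfl h ⟨j, rfl⟩ hj hj'
    have h1 := (pathThrough_cube hu (j - 1) (by omega)).map (f := fun X => (X, ({w} : Set W)))
      (Prod.mk_left_injective _) (s := JoinRel G H)
      (fun X Y h => joinRel_left (hdom X) (hdom Y) (Or.inl h))
    have := h1.hasCycle h (by
      have hne : ({w} : Set W) ≠ ∅ := singleton_ne_empty w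
      rintro ⟨X, Y⟩
      refine ⟨?_, ?_⟩
      · rintro ⟨Z, ⟨h1, h2⟩, h⟩
        rw [Prod.mk.injEq] at h
        obtain ⟨rfl, rfl⟩ := h
        exact ⟨fun h => hne h.2, fun h => h1 (Prod.mk.inj h).1, fun h => h2 (Prod.mk.inj h).1⟩
      · rintro ⟨-, h⟩
        have h : Y = ∅ := h
        subst h
        exact ⟨fun h => hne (Prod.mk.inj h).2.symm, fun h => hne (Prod.mk.inj h).2.symm⟩) (by
      rintro h
      exact hu ((Prod.mk.inj h).1 ▸ mem_insert u X))
    convert this using 1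
    omega
  have hvu : univ = insert v (univ \ {v}) := by simp
  have hslide : JoinRel G H (univ, ∅) (univ \ {v}, {w}) :=
    joinRel_of_eq_insert (by simp) hvu (notMem_empty w) (by simp)
      (dom_left isDominatingSet_univ) (hdom _)
  have hcH : Nat.card {Y // H.IsDominatingSet Y} ≤ 1 := by
    have := card_dominating_le (G := H)
    rwa [hW] at this
  refine isPancyclic_join_of_hasCycle fun k hk hk' => ?_
  rw [hW, ← hlen] at hk'
  have hkV : k ≤ 2 ^ Nat.card V + (l.length + 1) := by
    have : 0 < 2 ^ Nat.card V := by positivity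
    omega
  by_cases hk2 : k ≤ 2 ^ Nat.card V + 1
  · rcases Nat.even_or_odd k with he | ho
    · exact cube (k := 0) (m := k) (by simp) hvu
        (.of_rel (joinRel_left (hdom _) (hdom _)
          (Or.inl (SimpleGraph.TARAdj.symm (by
            conv_rhs => rw [hvu]
            exact tarAdj_insert_right (by simp)))))) he.two_dvd (by omega)
        (by have := he.two_dvd; omega)
    · have h1 : PathThrough (JoinRel G H) {x | x.1.Nonempty ∧ x.2 = ∅} (univ, {w})
          (univ \ {v}, {w}) 1 :=
        (PathThrough.of_rel (S := ∅) joinRel_univ_empty).trans (.of_rel (S := ∅) hslide)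
          (by simp) ⟨univ_nonempty, rfl⟩
      have := cube (k := 1) (m := k - 1) (by simp) hvu h1
        (by obtain ⟨j, rfl⟩ := ho; simp) (by omega) (by omega)
      rwa [Nat.sub_add_cancel (by omega)] at this
  by_cases hpar : 2 ∣ k - (l.length + 1)
  · have hlk : l.length + 1 ≤ 2 ^ Nat.card V := by
      rw [hlen]
      exact card_dominating_le.trans (Nat.sub_le _ _)
    have := cube (by simp) hvu (pathThrough_left hnd hc hld hv joinRel_univ_empty (hdom _)) hpar
      (by omega) (by omega)
    rwa [Nat.sub_add_cancel (by omega)] at this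
  -- The parity is wrong for the full detour, so `univ` is dropped: start at its successor `univ \
  -- {v'}` and leave `univ \ {v}` by sliding from `v'` to `w`.
  · have hlk : l.length + 1 ≤ 2 ^ Nat.card V := by
      rw [hlen]
      exact card_dominating_le.trans (Nat.sub_le _ _)
    have hl2 : 2 ≤ l.length := by omega
    have hv := hv.resolve_left (by rintro rfl; simp at hl2)
    obtain ⟨X, t, rfl⟩ : ∃ X t, l = X :: t := by
      cases l with
      | nil => simp at hl2
      | cons X t => exact ⟨X, t, rfl⟩
    rw [List.isChain_cons_cons] at hc
    obtain ⟨v', rfl⟩ := exists_of_tarsRel_univ hc.1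
    have hvv : v ≠ v' := by
      rintro rfl
      have ht : t ≠ [] := by rintro rfl; simp at hl2
      have h1 := (List.nodup_cons.1 (List.nodup_cons.1 hnd).2).1
      rw [List.getLast?_cons_of_ne_nil ht] at hv
      exact h1 (List.mem_of_getLast? hv)
    have hX : univ \ {v'} = insert v ((univ \ {v'}) \ {v}) := by simp [hvv]
    have hX' : univ \ {v} = insert v' ((univ \ {v'}) \ {v}) := by
      ext z
      simp only [mem_sdiff, mem_univ, mem_singleton_iff, true_and, mem_insert_iff]
      by_cases h : z = v'
      · subst h; simp [Ne.symm hvv]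
      · simp [h]
    have h1 := PathThrough.of_list (r := JoinRel G H)
      (l := ((univ \ {v'}) :: t).map fun X => (X, (∅ : Set W)))
      (S := {x | x.1.Nonempty ∧ x.2 = ∅}) (a := (univ \ {v'}, {w}))
      (b := ((univ \ {v'}) \ {v}, {w})) (by simp)
      ((List.nodup_cons.1 hnd).2.map (Prod.mk_left_injective _)) (by
        intro x hx
        obtain ⟨Z, hZ, rfl⟩ := List.mem_map.1 hx
        exact ⟨nonempty_of_isDominatingSet (hld Z (List.mem_cons_of_mem _ hZ)), rfl⟩)
      (isChain_map_left hc.2) (by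
        intro x hx
        obtain rfl : x = (univ \ {v'}, ∅) := by simpa using hx.symm
        refine (joinRel_right (dom_left hc.1.2.1) (hdom _) (Or.inl ?_)).symm
        simpa using tarAdj_insert_right (X := (∅ : Set W)) (w := w) (by simp)) (by
        intro x hx
        obtain rfl : x = (univ \ {v}, ∅) := by
          rw [List.getLast?_map, hv] at hx
          simpa using hx.symm
        exact joinRel_of_eq_insert (by simp) hX' (notMem_empty w) (by simp)
          (dom_left (hld _ (List.mem_cons_of_mem _ (List.mem_of_getLast? hv)))) (hdom _))
    rw [List.length_map] at h1
    have := cube (m := k - (((univ \ {v'}) :: t).length)) (by simp) hX h1 (by omega) (by omega)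
      (by omega)
    rwa [Nat.sub_add_cancel (by omega)] at this

end TarsCycles

/-! ### Assembling the cases; multipartite and split graphs -/

namespace TarsCycles

open Set SimpleGraph

variable {V : Type u} {W : Type v} {G : SimpleGraph V} {H : SimpleGraph W}

/-- Joining with the graph without vertices changes nothing. -/
def joinEmpty [IsEmpty W] (G : SimpleGraph V) (H : SimpleGraph W) : G ≃g G.join H where
  toEquiv := (Equiv.sumEmpty V W).symm
  map_rel_iff' := by simp

/-- A graph with all edges between a set and its complement is the join of the two induced
subgraphs. -/
noncomputable def joinInduceCompl {K : Set V} (h : ∀ x ∈ K, ∀ y ∉ K, G.Adj x y) :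
    (G.induce K).join (G.induce Kᶜ) ≃g G := by
  classical
  exact
    { toEquiv := Equiv.Set.sumCompl K
      map_rel_iff' := by
        rintro (⟨a, ha⟩ | ⟨a, ha⟩) (⟨b, hb⟩ | ⟨b, hb⟩)
        · simp
        · simpa using h a ha b hb
        · simpa using (h b hb a ha).symm
        · simp }

theorem isPancyclic_join_of_card_le [Finite V] [Finite W] (hG : G.tarsGraph.IsPancyclic)
    (hH : H.tarsGraph.IsPancyclic) (hVW : Nat.card W ≤ Nat.card V) :
    (G.join H).tarsGraph.IsPancyclic := by
  rcases (show Nat.card W = 0 ∨ Nat.card W = 1 ∨ 2 ≤ Nat.card W by omega) with h | h | h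
  · have : IsEmpty W := Finite.card_eq_zero_iff.1 h
    exact IsPancyclic.tars_iso (joinEmpty G H) hG
  · have : Nonempty V := Finite.card_pos_iff.1 (by omega)
    exact isPancyclic_join_of_card_eq_one hG h
  · by_cases hV : 3 ≤ Nat.card V
    · exact isPancyclic_join_of_three_le hG hH hV h hVW
    · exact isPancyclic_join_of_card_eq_two hG hH (by omega) (by omega)

/-- The join of two graphs with pancyclic TARS-graphs has a pancyclic TARS-graph. -/
theorem isPancyclic_join [Finite V] [Finite W] (hG : G.tarsGraph.IsPancyclic)
    (hH : H.tarsGraph.IsPancyclic) : (G.join H).tarsGraph.IsPancyclic := by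
  rcases le_total (Nat.card W) (Nat.card V) with h | h
  · exact isPancyclic_join_of_card_le hG hH h
  · exact IsPancyclic.tars_iso (joinComm H G) (isPancyclic_join_of_card_le hH hG h)

theorem isPancyclic_bot [Finite V] : (⊥ : SimpleGraph V).tarsGraph.IsPancyclic := by
  intro k hk hk'
  have h : ∀ X : {X // (⊥ : SimpleGraph V).IsDominatingSet X}, X.1 = univ := fun X =>
    eq_univ_of_forall fun w => (X.2 w).resolve_right (by simp)
  have : Subsingleton {X // (⊥ : SimpleGraph V).IsDominatingSet X} :=
    ⟨fun X Y => Subtype.ext ((h X).trans (h Y).symm)⟩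
  have := Finite.card_le_one_iff_subsingleton.2 this
  omega

/-- The non-neighbours of a vertex form its part; split this edgeless part off as a join factor and
induct on the rest. -/
theorem isPancyclic_of_isCompleteMultipartite [Finite V] (h : G.IsCompleteMultipartite) :
    G.tarsGraph.IsPancyclic := by
  induction hn : Nat.card V using Nat.strong_induction_on generalizing V with
  | _ n ih =>
    rcases isEmpty_or_nonempty V with hV | ⟨⟨v⟩⟩
    · rw [Subsingleton.elim G ⊥]
      exact isPancyclic_bot
    have hK : ∀ x ∈ {x | ¬ G.Adj v x}, ∀ y ∉ {x | ¬ G.Adj v x}, G.Adj x y := by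
      intro x hx y hy
      by_contra hxy
      exact hy (h.trans v x y hx hxy)
    refine IsPancyclic.tars_iso (joinInduceCompl hK) (isPancyclic_join ?_ (ih _ ?_ h.induce rfl))
    · have : G.induce {x | ¬ G.Adj v x} = ⊥ := by
        ext ⟨x, hx⟩ ⟨y, hy⟩
        simp only [comap_adj, Function.Embedding.subtype_apply, bot_adj, iff_false]
        exact h.trans x v y (fun h => hx h.symm) hy
      rw [this]
      exact isPancyclic_bot
    · rw [← hn]
      exact Finite.card_subtype_lt (x := v) (by simp)

theorem isPancyclic_of_isCompleteSplit [Finite V] (h : G.IsCompleteSplit) :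
    G.tarsGraph.IsPancyclic := by
  obtain ⟨K, hK, hI, hKI⟩ := h
  refine IsPancyclic.tars_iso (joinInduceCompl hKI) (isPancyclic_join ?_ ?_)
  · rw [induce_eq_top.2 hK]
    refine isPancyclic_of_isCompleteMultipartite ⟨fun a b c hab hbc => ?_⟩
    simp_all
  · have : G.induce Kᶜ = ⊥ := by
      ext ⟨x, hx⟩ ⟨y, hy⟩
      simp only [comap_adj, Function.Embedding.subtype_apply, bot_adj, iff_false]
      exact fun hxy => hI hx hy hxy.ne hxy
    rw [this]
    exact isPancyclic_bot

end TarsCycles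

theorem mainTheorem2 :
    (∀ (V : Type u) (W : Type v) [Finite V] [Finite W] (G : SimpleGraph V) (H : SimpleGraph W),
      G.tarsGraph.IsPancyclic → H.tarsGraph.IsPancyclic → (G.join H).tarsGraph.IsPancyclic) ∧
    (∀ (V : Type u) [Finite V] (G : SimpleGraph V),
      G.IsCompleteMultipartite → G.tarsGraph.IsPancyclic) ∧
    (∀ (V : Type u) [Finite V] (G : SimpleGraph V),
      G.IsCompleteSplit → G.tarsGraph.IsPancyclic) :=
  ⟨fun _ _ _ _ _ _ hG hH => TarsCycles.isPancyclic_join hG hH,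
    fun _ _ _ h => TarsCycles.isPancyclic_of_isCompleteMultipartite h,
    fun _ _ _ h => TarsCycles.isPancyclic_of_isCompleteSplit h⟩
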